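/- Let $n\ge 2$ be an integer, $0<s<1$, $1\le p<\infty$ with $sp<n$, put $p^*_s:=\frac{np}{n-sp}$, and let $1\le p^*_s\le r<q<\infty$. Let $K,V:\mathbb{R}^n\to(0,\infty)$ be Lebesgue measurable, with $\inf_D V>0$ for every compact set $D\subset\mathbb{R}^n$. Let $M_V^{s;q,p}(\mathbb{R}^n)$ be the completion of the space of those $u\in C^1_c(\mathbb{R}^n)$ for which the norm $$\|u\|:=\Bigl(\int_{\mathbb{R}^n}|u|^qV\,dx\Bigr)^{1/q}+\Bigl(\iint_{\mathbb{R}^n\times\mathbb{R}^n}\frac{|u(x)-u(y)|^p}{|x-y|^{n+sp}}\,dx\,dy\Bigr)^{1/p}$$ is finite, with respect to this norm, and let $L^r(K;\mathbb{R}^n)$ be the Lebesgue space with norm $\bigl(\int_{\mathbb{R}^n}|u|^rK\,dx\bigr)^{1/r}$. Suppose that $K\in L^t_{\mathrm{loc}}(\mathbb{R}^n)$ for some $t\in\bigl(\frac{q}{q-r},\infty\bigr]$, and that $K^{\psi(\tau)}V^{-\tau}\in L^1(\mathbb{R}^n)$ for some $\tau\in\bigl[\frac{r}{q-r},\infty\bigr)$,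 where $$\psi(\tau):=\frac{p^*_s+\tau(p^*_s-q)}{p^*_s-r};$$ if $r=p^*_s$, only $\tau=\frac{r}{q-r}$ is allowed and $\psi(\tau)$ is read as $\frac{q}{q-r}$, the value that the formula gives at $\tau=\frac{r}{q-r}$ for every $r\ne p^*_s$. Then the inclusion of test functions extends to an injective continuous linear map $M_V^{s;q,p}(\mathbb{R}^n)\to L^r(K;\mathbb{R}^n)$, and this embedding is compact. (No positive lower bound of $V$ on all of $\mathbb{R}^n$ is assumed.) -/

import Mathlib

open MeasureTheory
open scoped ENNReal

noncomputable section

namespace FracSobolev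

instance fact_one_le_ofReal (p : ℝ) [hp : Fact (1 ≤ p)] : Fact (1 ≤ ENNReal.ofReal p) :=
  ⟨ENNReal.one_le_ofReal.2 hp.out⟩

/-- The measure `W(x) dx` on `ℝⁿ`. The weighted space `L^r(W; ℝⁿ)` is `Lp ℝ r (weighted n W)`. -/
def weighted (n : ℕ) (W : EuclideanSpace ℝ (Fin n) → ℝ) :
    Measure (EuclideanSpace ℝ (Fin n)) :=
  volume.withDensity fun x => ENNReal.ofReal (W x)

/-- The Gagliardo seminorm
`[u]_{s,p} = (∬ |u(x) - u(y)|^p / |x - y|^(n + s p) dx dy)^(1/p)`, with values in `[0, ∞]`. -/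
def gagliardo (n : ℕ) (s p : ℝ) (u : EuclideanSpace ℝ (Fin n) → ℝ) : ℝ≥0∞ :=
  (∫⁻ z : EuclideanSpace ℝ (Fin n) × EuclideanSpace ℝ (Fin n),
    ‖u z.1 - u z.2‖ₑ ^ p / ‖z.1 - z.2‖ₑ ^ ((n : ℝ) + s * p)) ^ (1 / p)

lemma gagliardo_eq (n : ℕ) (s p : ℝ) {u : EuclideanSpace ℝ (Fin n) → ℝ} (hu : Continuous u) :
    gagliardo n s p u =
      (∫⁻ z : EuclideanSpace ℝ (Fin n) × EuclideanSpace ℝ (Fin n), ‖u z.1 - u z.2‖ₑ ^ p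
        ∂(volume.withDensity fun z => (‖z.1 - z.2‖ₑ ^ ((n : ℝ) + s * p))⁻¹)) ^ (1 / p) := by
  have hw : Measurable fun z : EuclideanSpace ℝ (Fin n) × EuclideanSpace ℝ (Fin n) =>
      (‖z.1 - z.2‖ₑ ^ ((n : ℝ) + s * p))⁻¹ := by fun_prop
  have hf : Measurable fun z : EuclideanSpace ℝ (Fin n) × EuclideanSpace ℝ (Fin n) =>
      ‖u z.1 - u z.2‖ₑ ^ p := by
    have := hu.measurable
    fun_prop
  rw [lintegral_withDensity_eq_lintegral_mul _ hw hf, gagliardo]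
  congr 1
  refine lintegral_congr fun z => ?_
  simp [div_eq_mul_inv, mul_comm]

lemma gagliardo_zero (n : ℕ) (s p : ℝ) (hp : 0 < p) : gagliardo n s p 0 = 0 := by
  simp [gagliardo, ENNReal.zero_rpow_of_pos hp, hp]

lemma gagliardo_add_le (n : ℕ) (s p : ℝ) (hp : 1 ≤ p) {u v : EuclideanSpace ℝ (Fin n) → ℝ}
    (hu : Continuous u) (hv : Continuous v) :
    gagliardo n s p (u + v) ≤ gagliardo n s p u + gagliardo n s p v := by
  rw [gagliardo_eq n s p hu, gagliardo_eq n s p hv, gagliardo_eq n s p (hu.add hv)]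
  have mu := hu.measurable
  have mv := hv.measurable
  refine le_trans ?_ (ENNReal.lintegral_Lp_add_le
    (f := fun z : EuclideanSpace ℝ (Fin n) × EuclideanSpace ℝ (Fin n) => ‖u z.1 - u z.2‖ₑ)
    (g := fun z => ‖v z.1 - v z.2‖ₑ)
    (by fun_prop) (by fun_prop) hp)
  gcongr with z
  have : (u + v) z.1 - (u + v) z.2 = (u z.1 - u z.2) + (v z.1 - v z.2) := by
    simp only [Pi.add_apply]; ring
  rw [this]
  exact enorm_add_le _ _

lemma gagliardo_smul (n : ℕ) (s p : ℝ) (hp : 0 < p) (c : ℝ)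
    (u : EuclideanSpace ℝ (Fin n) → ℝ) :
    gagliardo n s p (c • u) = ‖c‖ₑ * gagliardo n s p u := by
  have h : ∀ z : EuclideanSpace ℝ (Fin n) × EuclideanSpace ℝ (Fin n),
      ‖(c • u) z.1 - (c • u) z.2‖ₑ ^ p / ‖z.1 - z.2‖ₑ ^ ((n : ℝ) + s * p) =
      ‖c‖ₑ ^ p * (‖u z.1 - u z.2‖ₑ ^ p / ‖z.1 - z.2‖ₑ ^ ((n : ℝ) + s * p)) := fun z => by
    rw [Pi.smul_apply, Pi.smul_apply, ← smul_sub, enorm_smul,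
      ENNReal.mul_rpow_of_nonneg _ _ hp.le, mul_div_assoc]
  rw [gagliardo, gagliardo, lintegral_congr h,
    lintegral_const_mul' _ _ (ENNReal.rpow_ne_top_of_nonneg hp.le enorm_ne_top),
    ENNReal.mul_rpow_of_nonneg _ _ (by positivity), ← ENNReal.rpow_mul,
    mul_one_div_cancel hp.ne', ENNReal.rpow_one]

/-- The functions `u ∈ C_c^1(ℝⁿ)` for which `∫ |u|^q V dx` and `[u]_{s,p}` are finite. -/
def testFunctions (n : ℕ) (s p q : ℝ) [hp : Fact (1 ≤ p)] [hq : Fact (1 ≤ q)]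
    (V : EuclideanSpace ℝ (Fin n) → ℝ) : Submodule ℝ (EuclideanSpace ℝ (Fin n) → ℝ) where
  carrier := {u | ContDiff ℝ 1 u ∧ HasCompactSupport u ∧
    eLpNorm u (ENNReal.ofReal q) (weighted n V) < ∞ ∧ gagliardo n s p u < ∞}
  zero_mem' := ⟨contDiff_const, HasCompactSupport.zero, by simp,
    by rw [gagliardo_zero n s p (by linarith [hp.out])]; simp⟩
  add_mem' := by
    rintro u v ⟨hu, hu', hu1, hu2⟩ ⟨hv, hv', hv1, hv2⟩
    refine ⟨hu.add hv, hu'.add hv', ?_, ?_⟩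
    · exact (eLpNorm_add_le hu.continuous.aestronglyMeasurable
        hv.continuous.aestronglyMeasurable (Fact.out : 1 ≤ ENNReal.ofReal q)).trans_lt
        (ENNReal.add_lt_top.2 ⟨hu1, hv1⟩)
    · exact (gagliardo_add_le n s p hp.out hu.continuous hv.continuous).trans_lt
        (ENNReal.add_lt_top.2 ⟨hu2, hv2⟩)
  smul_mem' := by
    rintro c u ⟨hu, hu', hu1, hu2⟩
    refine ⟨hu.const_smul c, hu'.smul_left (f := fun _ => c), ?_, ?_⟩
    · rw [eLpNorm_const_smul]
      exact ENNReal.mul_lt_top enorm_lt_top hu1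
    · rw [gagliardo_smul n s p (by linarith [hp.out])]
      exact ENNReal.mul_lt_top enorm_lt_top hu2

/-- The space of test functions, to be normed by `‖u‖_{L^q(V)} + [u]_{s,p}`. -/
def PreMV (n : ℕ) (s p q : ℝ) [Fact (1 ≤ p)] [Fact (1 ≤ q)]
    (V : EuclideanSpace ℝ (Fin n) → ℝ) : Type :=
  testFunctions n s p q V

section PreMV

variable {n : ℕ} {s p q : ℝ} [hp : Fact (1 ≤ p)] [hq : Fact (1 ≤ q)]
  {V : EuclideanSpace ℝ (Fin n) → ℝ}

/-- The underlying function of a test function. -/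
def PreMV.toFun (u : PreMV n s p q V) : EuclideanSpace ℝ (Fin n) → ℝ :=
  Subtype.val u

instance : AddCommGroup (PreMV n s p q V) :=
  inferInstanceAs (AddCommGroup (testFunctions n s p q V))

instance : Module ℝ (PreMV n s p q V) :=
  inferInstanceAs (Module ℝ (testFunctions n s p q V))

/-- The norm `‖u‖ = ‖u‖_{L^q(V)} + [u]_{s,p}`. -/
instance : Norm (PreMV n s p q V) where
  norm u := (eLpNorm u.toFun (ENNReal.ofReal q) (weighted n V)).toReal
    + (gagliardo n s p u.toFun).toReal

lemma PreMV.norm_def (u : PreMV n s p q V) :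
    ‖u‖ = (eLpNorm u.toFun (ENNReal.ofReal q) (weighted n V)).toReal
      + (gagliardo n s p u.toFun).toReal := rfl

lemma PreMV.mem (u : PreMV n s p q V) : ContDiff ℝ 1 u.toFun ∧ HasCompactSupport u.toFun ∧
    eLpNorm u.toFun (ENNReal.ofReal q) (weighted n V) < ∞ ∧ gagliardo n s p u.toFun < ∞ :=
  Subtype.property u

lemma PreMV.toFun_add (u v : PreMV n s p q V) : (u + v).toFun = u.toFun + v.toFun := rfl

lemma PreMV.toFun_smul (c : ℝ) (u : PreMV n s p q V) : (c • u).toFun = c • u.toFun := rfl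

lemma PreMV.core : SeminormedSpace.Core ℝ (PreMV n s p q V) where
  norm_nonneg u := by rw [PreMV.norm_def]; positivity
  norm_smul c u := by
    rw [PreMV.norm_def, PreMV.norm_def, PreMV.toFun_smul, eLpNorm_const_smul,
      gagliardo_smul n s p (by linarith [hp.out]), ENNReal.toReal_mul, ENNReal.toReal_mul,
      toReal_enorm]
    ring
  norm_triangle u v := by
    obtain ⟨hu, -, hu1, hu2⟩ := u.mem
    obtain ⟨hv, -, hv1, hv2⟩ := v.mem
    have h1 := ENNReal.toReal_mono (ENNReal.add_lt_top.2 ⟨hu1, hv1⟩).ne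
      (eLpNorm_add_le (μ := weighted n V) hu.continuous.aestronglyMeasurable
        hv.continuous.aestronglyMeasurable (Fact.out : 1 ≤ ENNReal.ofReal q))
    have h2 := ENNReal.toReal_mono (ENNReal.add_lt_top.2 ⟨hu2, hv2⟩).ne
      (gagliardo_add_le n s p hp.out hu.continuous hv.continuous)
    rw [ENNReal.toReal_add hu1.ne hv1.ne] at h1
    rw [ENNReal.toReal_add hu2.ne hv2.ne] at h2
    rw [PreMV.norm_def, PreMV.norm_def, PreMV.norm_def, PreMV.toFun_add]
    linarith

instance : SeminormedAddCommGroup (PreMV n s p q V) :=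
  SeminormedAddCommGroup.ofCore PreMV.core

instance : NormedSpace ℝ (PreMV n s p q V) where
  norm_smul_le c u := (PreMV.core.norm_smul c u).le

end PreMV

/-- The Banach space `M_V^{s;q,p}(ℝⁿ)`: the completion of the test functions with respect to
`‖u‖_{L^q(V)} + [u]_{s,p}`. -/
abbrev MV (n : ℕ) (s p q : ℝ) [Fact (1 ≤ p)] [Fact (1 ≤ q)]
    (V : EuclideanSpace ℝ (Fin n) → ℝ) : Type :=
  UniformSpace.Completion (PreMV n s p q V)

/-- The fractional critical exponent `p*_s = n p / (n - s p)`. -/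
def critExp (n : ℕ) (s p : ℝ) : ℝ := n * p / (n - s * p)

/-- With `P = p*_s`, the exponent `ψ(τ) = (P + τ (P - q)) / (P - r)`. For `r ≠ P` its value at
`τ = r / (q - r)` is `q / (q - r)`; for `r = P` the quotient at this `τ` reads `0 / 0`, and it is
given the same value. -/
def psi (P q r τ : ℝ) : ℝ :=
  if r = P then q / (q - r) else (P + τ * (P - q)) / (P - r)

end FracSobolev

end

/-! Write P for the critical exponent and Ψ for ψ(τ). Hölder with three factors splits `K|u|^r` into
powers of `|u|^P`, `V|u|^q` and `K^Ψ V^(-τ)`. The fractional Sobolev inequality bounds the first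
integral and the norm bounds the second, which gives continuity. The estimate holds on every
measurable set, so the integrability of `K^Ψ V^(-τ)` makes the tails of all u in a bounded set
uniformly small (`exists_setLIntegral_weight_le`).

Compactness comes from finite-rank approximation in operator norm. On a large box u is replaced by
its averages over small cubes. The Gagliardo seminorm makes the error small in L^p, the lower bound
of V on the box keeps it bounded in L^q, and interpolation against `K ∈ L^t` makes it small in
L^r(K) (`exists_stepApprox_weight_le`).

Injectivity is a Fatou argument: a Cauchy sequence of test functions that tends to 0 in L^r(K) tends
to 0 a.e. along a subsequence, and both parts of the norm are lower semicontinuous under a.e.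
convergence (`tendsto_norm_zero_of_tendsto`). -/

namespace FracSobolev

/-! ### Operators extended to a completion: compactness and injectivity criteria. -/

section Abstract

open Filter Topology UniformSpace

variable {E F : Type*} [SeminormedAddCommGroup E] [NormedSpace ℝ E]
  [NormedAddCommGroup F] [NormedSpace ℝ F] [CompleteSpace F]

/-- Compact operators are closed in operator norm, and finite-rank bounds pass from the dense
subspace to the completion. -/
lemma isCompactOperator_fromCompletion (f : E →L[ℝ] F)
    (h : ∀ ε : ℝ, 0 < ε → ∃ (g : E →ₗ[ℝ] F) (W : Submodule ℝ F), FiniteDimensional ℝ W ∧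
      (∀ x, g x ∈ W) ∧ ∀ x, ‖f x - g x‖ ≤ ε * ‖x‖) :
    IsCompactOperator f.fromCompletion := by
  have hcl := isClosed_setOfPred_isCompactOperator (𝕜₁ := ℝ) (𝕜₂ := ℝ) (σ₁₂ := RingHom.id ℝ)
    (M₁ := Completion E) (M₂ := F)
  refine (Metric.mem_of_closed' hcl).2 fun ε hε => ?_
  obtain ⟨g, W, hW, hgW, hg⟩ := h (ε / 2) (by positivity)
  -- Continuity of g is not assumed: it follows because g stays within ε/2 of the bounded map f.
  let g' : E →L[ℝ] W := (g.codRestrict W hgW).mkContinuous (‖f‖ + ε / 2) fun x => by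
    have h1 : ‖g x‖ ≤ ‖f x‖ + ‖f x - g x‖ := by
      simpa using norm_sub_le (f x) (f x - g x)
    have h2 := hg x
    have h3 := f.le_opNorm x
    calc _ = ‖g x‖ := rfl
      _ ≤ _ := by linarith
  refine ⟨W.subtypeL.comp g'.fromCompletion, ?_, ?_⟩
  · exact (isCompactOperator_of_locallyCompactSpace_dom g'.fromCompletion).clm_comp W.subtypeL
  · rw [dist_eq_norm]
    refine lt_of_le_of_lt (ContinuousLinearMap.opNorm_le_bound _ (by positivity) fun x => ?_)
      (half_lt_self hε)
    induction x using Completion.induction_on with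
    | hp => exact isClosed_le (by fun_prop) (by fun_prop)
    | ih x =>
      rw [sub_apply, ContinuousLinearMap.comp_apply,
        ContinuousLinearMap.fromCompletion_apply_coe, ContinuousLinearMap.fromCompletion_apply_coe,
        Completion.norm_coe]
      exact hg x

/-- Injectivity of f would not be enough: a nonzero element of the completion may be a limit of
vectors whose images tend to 0. The hypothesis excludes exactly this. -/
lemma injective_fromCompletion (f : E →L[ℝ] F)
    (h : ∀ u : ℕ → E, CauchySeq u → Tendsto (fun k => f (u k)) atTop (𝓝 0) →
      Tendsto (fun k => ‖u k‖) atTop (𝓝 0)) :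
    Function.Injective f.fromCompletion := by
  rw [injective_iff_map_eq_zero]
  intro x hx
  obtain ⟨y, hy, hyx⟩ := mem_closure_iff_seq_limit.1 (Completion.denseRange_coe (α := E) x)
  choose u hu using hy
  obtain rfl : (fun k => (u k : Completion E)) = y := funext hu
  have h1 : CauchySeq u := by
    have := hyx.cauchySeq
    rw [CauchySeq, ← (Completion.isUniformInducing_coe E).cauchy_map_iff, map_map]
    exact this
  have h2 := (f.fromCompletion.continuous.tendsto x).comp hyx
  rw [hx] at h2
  have h3 := h u h1 (by simpa [Function.comp_def] using h2)
  have h4 := hyx.norm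
  simp only [Completion.norm_coe] at h4
  exact norm_eq_zero.1 (tendsto_nhds_unique h4 h3)

end Abstract

/-! ### Jensen's inequality for averages. -/

section Averages

variable {α : Type*} [MeasurableSpace α] {μ : Measure α}

lemma lintegral_rpow_le_measure_univ_mul {a : ℝ} (ha : 1 ≤ a) {f : α → ℝ≥0∞}
    (hf : AEMeasurable f μ) :
    (∫⁻ x, f x ∂μ) ^ a ≤ μ Set.univ ^ (a - 1) * ∫⁻ x, f x ^ a ∂μ := by
  have ha0 : 0 < a := by linarith
  have h := ENNReal.lintegral_mul_norm_pow_le (μ := μ) (f := fun x => f x ^ a) (g := fun _ => 1)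
    (p := 1 / a) (q := 1 - 1 / a) (hf.pow_const a) aemeasurable_const (by positivity)
    (by rw [sub_nonneg, div_le_one ha0]; exact ha) (by ring)
  simp only [← ENNReal.rpow_mul, mul_one_div_cancel ha0.ne', ENNReal.rpow_one, ENNReal.one_rpow,
    mul_one, lintegral_const, one_mul] at h
  calc (∫⁻ x, f x ∂μ) ^ a ≤ ((∫⁻ x, f x ^ a ∂μ) ^ (1 / a) * μ Set.univ ^ (1 - 1 / a)) ^ a := by
        gcongr
    _ = _ := by
        rw [ENNReal.mul_rpow_of_nonneg _ _ ha0.le, ← ENNReal.rpow_mul, ← ENNReal.rpow_mul,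
          one_div_mul_cancel ha0.ne', ENNReal.rpow_one, mul_comm]
        congr 2
        field_simp

lemma enorm_sub_average_rpow_le {a : ℝ} (ha : 1 ≤ a) [IsFiniteMeasure μ] (hμ : μ ≠ 0)
    {u : α → ℝ} (hu : Integrable u μ) (c : ℝ) :
    ‖c - ⨍ y, u y ∂μ‖ₑ ^ a ≤ (μ Set.univ)⁻¹ * ∫⁻ y, ‖c - u y‖ₑ ^ a ∂μ := by
  have h0 : μ Set.univ ≠ 0 := by simpa using hμ
  have ht : μ Set.univ ≠ ∞ := measure_ne_top _ _
  have : NeZero μ := ⟨hμ⟩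
  have h1 : c - ⨍ y, u y ∂μ = ⨍ y, (c - u y) ∂μ := by
    conv_lhs => rw [← average_const μ c]
    simp only [average_eq]
    rw [integral_sub (integrable_const _) hu, smul_sub]
  have h2 : ‖c - ⨍ y, u y ∂μ‖ₑ ≤ (μ Set.univ)⁻¹ * ∫⁻ y, ‖c - u y‖ₑ ∂μ := by
    rw [h1, average_eq, enorm_smul]
    gcongr
    · rw [Measure.real, enorm_inv (ENNReal.toReal_ne_zero.2 ⟨h0, ht⟩),
        Real.enorm_of_nonneg (by positivity), ENNReal.ofReal_toReal ht]
    · exact enorm_integral_le_lintegral_enorm _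
  calc _ ≤ ((μ Set.univ)⁻¹ * ∫⁻ y, ‖c - u y‖ₑ ∂μ) ^ a := by gcongr
    _ ≤ (μ Set.univ)⁻¹ ^ a * (μ Set.univ ^ (a - 1) * ∫⁻ y, ‖c - u y‖ₑ ^ a ∂μ) := by
        rw [ENNReal.mul_rpow_of_nonneg _ _ (by linarith)]
        gcongr
        exact lintegral_rpow_le_measure_univ_mul ha
          ((aemeasurable_const.sub hu.aestronglyMeasurable.aemeasurable).enorm)
    _ = _ := by
        rw [← mul_assoc, ENNReal.inv_rpow, ← ENNReal.rpow_neg, ← ENNReal.rpow_add _ _ h0 ht]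
        congr 1
        rw [← ENNReal.rpow_neg_one]; congr 1; ring

end Averages

/-! ### Local lower bounds for the Gagliardo integral. -/

section Gagliardo

variable {n : ℕ} {s p : ℝ} {u : EuclideanSpace ℝ (Fin n) → ℝ}

/-- The inner integral of the Gagliardo double integral. -/
noncomputable def gagliardoInner (n : ℕ) (s p : ℝ) (u : EuclideanSpace ℝ (Fin n) → ℝ)
    (x : EuclideanSpace ℝ (Fin n)) : ℝ≥0∞ :=
  ∫⁻ y, ‖u x - u y‖ₑ ^ p / ‖x - y‖ₑ ^ ((n : ℝ) + s * p)

lemma lintegral_gagliardoInner (hp : 0 < p) (hu : Continuous u) :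
    ∫⁻ x, gagliardoInner n s p u x = gagliardo n s p u ^ p := by
  have hm := hu.measurable
  rw [gagliardo, ← ENNReal.rpow_mul, one_div_mul_cancel hp.ne', ENNReal.rpow_one,
    Measure.volume_eq_prod, lintegral_prod _ (by fun_prop)]
  rfl

lemma enorm_rpow_le_mul_div {e : ℝ} (he : 0 < e) (hp : 0 < p) {x y : EuclideanSpace ℝ (Fin n)}
    {d : ℝ≥0∞} (h : ‖x - y‖ₑ ≤ d) :
    ‖u x - u y‖ₑ ^ p ≤ d ^ e * (‖u x - u y‖ₑ ^ p / ‖x - y‖ₑ ^ e) := by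
  by_cases hxy : x = y
  · subst hxy; simp [hp]
  have h1 : ‖x - y‖ₑ ^ e ≠ 0 := by
    simp [sub_eq_zero, hxy]
  have h2 : ‖x - y‖ₑ ^ e ≠ ∞ := ENNReal.rpow_ne_top_of_nonneg he.le enorm_ne_top
  calc _ = ‖x - y‖ₑ ^ e * (‖u x - u y‖ₑ ^ p / ‖x - y‖ₑ ^ e) := (ENNReal.mul_div_cancel h1 h2).symm
    _ ≤ _ := by gcongr

lemma setLIntegral_enorm_sub_rpow_le (hs : 0 < s) (hp : 0 < p) {Q : Set (EuclideanSpace ℝ (Fin n))}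
    (hQ : MeasurableSet Q) {x : EuclideanSpace ℝ (Fin n)} {d : ℝ≥0∞}
    (hd : ∀ y ∈ Q, ‖x - y‖ₑ ≤ d) (hu : Continuous u) :
    ∫⁻ y in Q, ‖u x - u y‖ₑ ^ p ≤ d ^ ((n : ℝ) + s * p) *
      ∫⁻ y in Q, ‖u x - u y‖ₑ ^ p / ‖x - y‖ₑ ^ ((n : ℝ) + s * p) := by
  have hm := hu.measurable
  rw [← lintegral_const_mul _ (by fun_prop)]
  exact setLIntegral_mono' hQ fun y hy =>
    enorm_rpow_le_mul_div (by positivity) hp (hd y hy)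

end Gagliardo

/-! ### The fractional Sobolev inequality by Hedberg's method. -/

section Sobolev

variable {n : ℕ} {s p : ℝ} {u : EuclideanSpace ℝ (Fin n) → ℝ}

lemma critExp_pos (hn : 0 < n) (hp : 1 ≤ p) (hsp : s * p < n) : 0 < critExp n s p := by
  have : (0 : ℝ) < n := by exact_mod_cast hn
  unfold critExp
  have : 0 < n - s * p := by linarith
  positivity

lemma lt_critExp (hn : 0 < n) (hs : 0 < s) (hp : 1 ≤ p) (hsp : s * p < n) :
    p < critExp n s p := by
  have : (0 : ℝ) < n := by exact_mod_cast hn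
  unfold critExp
  rw [lt_div_iff₀ (by linarith)]
  nlinarith [mul_pos (mul_pos hs (by linarith : 0 < p)) (by linarith : 0 < p)]

/-- Hedberg-type pointwise bound before optimising the radius. -/
lemma enorm_rpow_le_ball (hn : 0 < n) (hs : 0 < s) (hp : 1 ≤ p) (hsp : s * p < n)
    (hu : Continuous u) (x : EuclideanSpace ℝ (Fin n)) {R : ℝ≥0∞} (hR0 : R ≠ 0) (hR : R ≠ ∞)
    {b : ℝ≥0∞} (hb : b = volume (Metric.ball (0 : EuclideanSpace ℝ (Fin n)) 1)) :
    ‖u x‖ₑ ^ p ≤ 2 ^ (p - 1) * (b⁻¹ * (R ^ (s * p) * gagliardoInner n s p u x)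
      + b ^ (-(p / critExp n s p)) * (R ^ (-(n - s * p)) *
        (∫⁻ y, ‖u y‖ₑ ^ critExp n s p) ^ (p / critExp n s p))) := by
  have hn' : (0 : ℝ) < n := by exact_mod_cast hn
  have hp0 : 0 < p := by linarith
  set P := critExp n s p with hP
  have hP0 : 0 < P := critExp_pos hn hp hsp
  have hpP : p < P := lt_critExp hn hs hp hsp
  have hb0 : b ≠ 0 := hb ▸ (Metric.measure_ball_pos _ _ one_pos).ne'
  have hbt : b ≠ ∞ := hb ▸ measure_ball_lt_top.ne
  have hm := hu.measurable
  set B := Metric.ball x R.toReal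
  have hR' : ENNReal.ofReal R.toReal = R := ENNReal.ofReal_toReal hR
  have hRpos : 0 < R.toReal := ENNReal.toReal_pos hR0 hR
  have hv : volume B = R ^ (n : ℝ) * b := by
    rw [hb, Measure.addHaar_ball_of_pos _ _ hRpos, ENNReal.ofReal_pow hRpos.le, hR',
      ENNReal.rpow_natCast, finrank_euclideanSpace_fin]
  set v := R ^ (n : ℝ) * b
  have hv0 : v ≠ 0 := mul_ne_zero (by simp [hR0]) hb0
  have hvt : v ≠ ∞ := ENNReal.mul_ne_top (ENNReal.rpow_ne_top_of_nonneg hn'.le hR) hbt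
  -- Integrate the constant `|u x|^p` over the ball and split `u x = (u x - u y) + u y`. The
  -- difference is controlled by the kernel, since `|x - y| ≤ R`; the rest by Hölder from L^p to
  -- L^P.
  have h1 : v * ‖u x‖ₑ ^ p ≤ 2 ^ (p - 1) * (R ^ (n + s * p) * gagliardoInner n s p u x
      + v ^ (1 - p / P) * (∫⁻ y, ‖u y‖ₑ ^ P) ^ (p / P)) := by
    calc v * ‖u x‖ₑ ^ p = ∫⁻ y in B, ‖u x‖ₑ ^ p := by rw [setLIntegral_const, hv, mul_comm]
      _ ≤ ∫⁻ y in B, 2 ^ (p - 1) * (‖u x - u y‖ₑ ^ p + ‖u y‖ₑ ^ p) := by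
          refine lintegral_mono fun y => ?_
          calc ‖u x‖ₑ ^ p ≤ (‖u x - u y‖ₑ + ‖u y‖ₑ) ^ p := by
                gcongr
                simpa using enorm_add_le (u x - u y) (u y)
            _ ≤ _ := by
              rw [mul_add]
              simpa [mul_add] using
                ENNReal.rpow_add_le_mul_rpow_add_rpow ‖u x - u y‖ₑ ‖u y‖ₑ hp
      _ = 2 ^ (p - 1) * ((∫⁻ y in B, ‖u x - u y‖ₑ ^ p) + ∫⁻ y in B, ‖u y‖ₑ ^ p) := by
          rw [lintegral_const_mul _ (by fun_prop), lintegral_add_left (by fun_prop)]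
      _ ≤ _ := by
          gcongr
          · refine (setLIntegral_enorm_sub_rpow_le hs hp0 Metric.isOpen_ball.measurableSet
              (d := R) (fun y hy => ?_) hu).trans ?_
            · rw [← hR', ← ofReal_norm]
              refine ENNReal.ofReal_le_ofReal ?_
              rw [← dist_eq_norm, dist_comm]; exact (Metric.mem_ball.1 hy).le
            · gcongr
              exact setLIntegral_le_lintegral _ _
          · have h := lintegral_rpow_le_measure_univ_mul (μ := volume.restrict B) (a := P / p)
              (by rw [le_div_iff₀ hp0]; linarith) (f := fun y => ‖u y‖ₑ ^ p) (by fun_prop)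
            simp only [← ENNReal.rpow_mul, mul_div_cancel₀ P hp0.ne', Measure.restrict_apply_univ,
              hv] at h
            calc ∫⁻ y in B, ‖u y‖ₑ ^ p = ((∫⁻ y in B, ‖u y‖ₑ ^ p) ^ (P / p)) ^ (p / P) := by
                  rw [← ENNReal.rpow_mul, div_mul_div_cancel₀ hp0.ne', div_self hP0.ne',
                    ENNReal.rpow_one]
              _ ≤ (v ^ (P / p - 1) * ∫⁻ y in B, ‖u y‖ₑ ^ P) ^ (p / P) := by gcongr
              _ = v ^ (1 - p / P) * (∫⁻ y in B, ‖u y‖ₑ ^ P) ^ (p / P) := by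
                  rw [ENNReal.mul_rpow_of_nonneg _ _ (by positivity), ← ENNReal.rpow_mul]
                  congr 2
                  field_simp
              _ ≤ _ := by
                  gcongr
                  exact Measure.restrict_le_self
  have h2 : ‖u x‖ₑ ^ p = v⁻¹ * (v * ‖u x‖ₑ ^ p) := by
    rw [← mul_assoc, ENNReal.inv_mul_cancel hv0 hvt, one_mul]
  have e1 : v⁻¹ * R ^ (n + s * p) = b⁻¹ * R ^ (s * p) := by
    rw [ENNReal.mul_inv (by simp [hbt]) (by simp [hb0]), ENNReal.rpow_add _ _ hR0 hR]
    calc _ = (R ^ (n : ℝ))⁻¹ * R ^ (n : ℝ) * (b⁻¹ * R ^ (s * p)) := by ring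
      _ = _ := by
        rw [ENNReal.inv_mul_cancel (by simp [hR0]) (ENNReal.rpow_ne_top_of_nonneg hn'.le hR),
          one_mul]
  have e2 : v⁻¹ * v ^ (1 - p / P) = b ^ (-(p / P)) * R ^ (-(n - s * p)) := by
    rw [← ENNReal.rpow_neg_one, ← ENNReal.rpow_add _ _ hv0 hvt,
      ENNReal.mul_rpow_of_ne_top (ENNReal.rpow_ne_top_of_nonneg hn'.le hR) hbt,
      ← ENNReal.rpow_mul, mul_comm]
    have : n - s * p ≠ 0 := by linarith
    congr 2
    · ring
    · rw [hP, critExp]; field_simp; ring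
  calc _ = v⁻¹ * (v * ‖u x‖ₑ ^ p) := h2
    _ ≤ v⁻¹ * _ := mul_le_mul_right h1 _
    _ = 2 ^ (p - 1) * (v⁻¹ * R ^ (n + s * p) * gagliardoInner n s p u x
        + v⁻¹ * v ^ (1 - p / P) * (∫⁻ y, ‖u y‖ₑ ^ P) ^ (p / P)) := by ring
    _ = _ := by rw [e1, e2]; ring

/-- The fractional Sobolev inequality. -/
theorem lintegral_critExp_le (hn : 0 < n) (hs : 0 < s) (hp : 1 ≤ p) (hsp : s * p < n) :
    ∃ C : ℝ≥0∞, C ≠ ∞ ∧ ∀ u : EuclideanSpace ℝ (Fin n) → ℝ, Continuous u → HasCompactSupport u →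
      ∫⁻ x, ‖u x‖ₑ ^ critExp n s p ≤ C * gagliardo n s p u ^ critExp n s p := by
  have hn' : (0 : ℝ) < n := by exact_mod_cast hn
  have hp0 : 0 < p := by linarith
  set P := critExp n s p with hP
  have hP0 : 0 < P := critExp_pos hn hp hsp
  obtain ⟨b, hb⟩ : ∃ b, b = volume (Metric.ball (0 : EuclideanSpace ℝ (Fin n)) 1) := ⟨_, rfl⟩
  have hb0 : b ≠ 0 := hb ▸ (Metric.measure_ball_pos _ _ one_pos).ne'
  have hbt : b ≠ ∞ := hb ▸ measure_ball_lt_top.ne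
  set σ := s * p / n with hσ
  have hσ0 : 0 < σ := by positivity
  have hσ1 : σ < 1 := by rw [hσ, div_lt_one hn']; exact hsp
  have hPp : P / p = 1 / (1 - σ) := by
    have : n - s * p ≠ 0 := by linarith
    rw [hP, critExp, hσ]; field_simp
  set C₁ : ℝ≥0∞ := 2 ^ (p - 1) * (b⁻¹ + b ^ (-(p / P)))
  have hC₁ : C₁ ≠ ∞ := ENNReal.mul_ne_top (by simp) <| ENNReal.add_ne_top.2
    ⟨by simp [hb0], by simp [hb0, hbt]⟩
  set C₂ := C₁ ^ (P / p)
  have hC₂ : C₂ ≠ ∞ := ENNReal.rpow_ne_top_of_nonneg (by positivity) hC₁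
  refine ⟨C₂ ^ (P / p), ENNReal.rpow_ne_top_of_nonneg (by positivity) hC₂, fun u hu hc => ?_⟩
  have hm := hu.measurable
  set A := ∫⁻ x, ‖u x‖ₑ ^ P with hA
  by_cases hA0 : A = 0
  · rw [hA0]; exact zero_le
  -- Finiteness, from compact support, is what later allows a power of A to be divided out.
  have hAt : A ≠ ∞ := by
    have := (hu.memLp_of_hasCompactSupport (μ := volume) (p := ENNReal.ofReal P) hc).2
    rw [eLpNorm_eq_lintegral_rpow_enorm_toReal (by simp [hP0]) (by simp),
      ENNReal.toReal_ofReal hP0.le] at this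
    intro h
    rw [← hA, h] at this
    simp [hP0] at this
  -- After optimising the radius, the inner Gagliardo integral appears to the power one, so the
  -- bound can be integrated in x.
  have key : ∀ x, ‖u x‖ₑ ^ P ≤ C₂ * A ^ σ * gagliardoInner n s p u x := by
    intro x
    have hc0 : C₂ * A ^ σ ≠ ∞ := ENNReal.mul_ne_top hC₂ (ENNReal.rpow_ne_top_of_nonneg hσ0.le hAt)
    have hc1 : C₂ * A ^ σ ≠ 0 :=
      mul_ne_zero (by simp [C₂, C₁, hbt, hP0, hp0, hC₁]) (by simp [hA0, hAt])
    rw [mul_comm, ← ENNReal.div_le_iff hc1 hc0]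
    -- The inner integral may be 0 or ∞, which would give a degenerate radius; a number g strictly
    -- above it replaces it.
    refine le_of_forall_gt_imp_ge_of_dense fun g hg => ?_
    by_cases hgt : g = ∞
    · rw [hgt]; exact le_top
    have hg0 : g ≠ 0 := (zero_le.trans_lt hg).ne'
    rw [ENNReal.div_le_iff hc1 hc0, mul_comm]
    set D := A ^ (p / P)
    have hD0 : D ≠ 0 := by simp [D, hA0, hAt]
    have hDt : D ≠ ∞ := ENNReal.rpow_ne_top_of_nonneg (by positivity) hAt
    have hDg0 : D * g⁻¹ ≠ 0 := mul_ne_zero hD0 (by simpa using hgt)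
    have hDgt : D * g⁻¹ ≠ ∞ := ENNReal.mul_ne_top hDt (by simpa using hg0)
    -- The choice `R^n = D / g` balances the two terms: both become `D^σ g^(1-σ)`.
    have hb1 := enorm_rpow_le_ball hn hs hp hsp hu x (R := (D * g⁻¹) ^ (1 / (n : ℝ)))
      (by simp [hDg0, hDgt]) (ENNReal.rpow_ne_top_of_nonneg (by positivity) hDgt) hb
    rw [← ENNReal.rpow_mul, ← ENNReal.rpow_mul, ← hP, ← hA] at hb1
    have e1 : (D * g⁻¹) ^ (1 / (n : ℝ) * (s * p)) * g = D ^ σ * g ^ (1 - σ) := by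
      rw [show 1 / (n : ℝ) * (s * p) = σ by rw [hσ]; ring,
        ENNReal.mul_rpow_of_nonneg _ _ hσ0.le, ENNReal.inv_rpow, ← ENNReal.rpow_neg, mul_assoc]
      nth_rewrite 2 [← ENNReal.rpow_one g]
      rw [← ENNReal.rpow_add _ _ hg0 hgt]
      congr 2; ring
    have e2 : (D * g⁻¹) ^ (1 / (n : ℝ) * -(n - s * p)) * D = D ^ σ * g ^ (1 - σ) := by
      rw [show 1 / (n : ℝ) * -(n - s * p) = σ - 1 by rw [hσ]; field_simp; ring,
        ENNReal.mul_rpow_of_ne_top hDt (by simpa using hg0), ENNReal.inv_rpow, ← ENNReal.rpow_neg,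
        mul_right_comm]
      nth_rewrite 2 [← ENNReal.rpow_one D]
      rw [← ENNReal.rpow_add _ _ hD0 hDt]
      congr 2 <;> ring
    have hb2 : ‖u x‖ₑ ^ p ≤ C₁ * (D ^ σ * g ^ (1 - σ)) := by
      refine hb1.trans ?_
      calc _ ≤ 2 ^ (p - 1) * (b⁻¹ * ((D * g⁻¹) ^ (1 / (n : ℝ) * (s * p)) * g)
            + b ^ (-(p / P)) * ((D * g⁻¹) ^ (1 / (n : ℝ) * -(n - s * p)) * D)) := by gcongr
        _ = _ := by rw [e1, e2]; ring
    calc ‖u x‖ₑ ^ P = (‖u x‖ₑ ^ p) ^ (P / p) := by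
          rw [← ENNReal.rpow_mul, mul_div_cancel₀ P hp0.ne']
      _ ≤ (C₁ * (D ^ σ * g ^ (1 - σ))) ^ (P / p) := by gcongr
      _ = C₂ * A ^ σ * g := by
          rw [ENNReal.mul_rpow_of_nonneg C₁ _ (by positivity),
            ENNReal.mul_rpow_of_nonneg (D ^ σ) _ (by positivity), ← ENNReal.rpow_mul D,
            ← ENNReal.rpow_mul A, ← ENNReal.rpow_mul g, show p / P * (σ * (P / p)) = σ by field_simp,
            show (1 - σ) * (P / p) = 1 by rw [hPp, mul_one_div_cancel (by linarith)],
            ENNReal.rpow_one, mul_assoc]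
  have h1 : A ≤ C₂ * A ^ σ * gagliardo n s p u ^ p := by
    rw [← lintegral_gagliardoInner hp0 hu]
    refine (lintegral_mono key).trans ?_
    rw [lintegral_const_mul' _ _ (ENNReal.mul_ne_top hC₂
      (ENNReal.rpow_ne_top_of_nonneg hσ0.le hAt))]
  -- Absorb `A^σ` into the left side; possible because `σ < 1` and A is neither 0 nor ∞.
  have h2 : A ^ (1 - σ) ≤ C₂ * gagliardo n s p u ^ p := by
    rw [sub_eq_add_neg, ENNReal.rpow_add _ _ hA0 hAt, ENNReal.rpow_one]
    calc _ ≤ C₂ * A ^ σ * gagliardo n s p u ^ p * A ^ (-σ) := by gcongr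
      _ = C₂ * gagliardo n s p u ^ p * (A ^ σ * A ^ (-σ)) := by ring
      _ = _ := by rw [← ENNReal.rpow_add _ _ hA0 hAt]; simp
  calc A = (A ^ (1 - σ)) ^ (P / p) := by
        rw [← ENNReal.rpow_mul, hPp, mul_one_div_cancel (by linarith), ENNReal.rpow_one]
    _ ≤ (C₂ * gagliardo n s p u ^ p) ^ (P / p) := by gcongr
    _ = _ := by
      rw [ENNReal.mul_rpow_of_nonneg _ _ (by positivity), ← ENNReal.rpow_mul (gagliardo n s p u),
        mul_div_cancel₀ P hp0.ne']

end Sobolev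

/-! ### Partitions of boxes into small cubes. -/

section Partition

variable {n : ℕ}

/-- The half-open box `[-m, m)ⁿ`. -/
def box (n m : ℕ) : Set (EuclideanSpace ℝ (Fin n)) := {x | ∀ i, x i ∈ Set.Ico (-(m : ℝ)) m}

lemma volume_setOf_mem_Ico (a b : Fin n → ℝ) :
    volume {x : EuclideanSpace ℝ (Fin n) | ∀ i, x i ∈ Set.Ico (a i) (b i)} =
      ∏ i, ENNReal.ofReal (b i - a i) := by
  rw [← Real.volume_pi_Ico, ← (EuclideanSpace.volume_preserving_symm_measurableEquiv_toLp
    (Fin n)).measure_preimage_equiv]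
  congr 1
  ext x
  simp [Set.mem_pi]

lemma measurableSet_setOf_mem_Ico (a b : Fin n → ℝ) :
    MeasurableSet {x : EuclideanSpace ℝ (Fin n) | ∀ i, x i ∈ Set.Ico (a i) (b i)} := by
  have h (i : Fin n) : Measurable fun x : EuclideanSpace ℝ (Fin n) => x i := by fun_prop
  rw [Set.ofPred_forall]
  exact MeasurableSet.iInter fun i => h i measurableSet_Ico

lemma measurableSet_box (m : ℕ) : MeasurableSet (box n m) :=
  measurableSet_setOf_mem_Ico _ _

lemma box_mono : Monotone (box n) := fun a b h x hx i => by
  have h' : (a : ℝ) ≤ b := by exact_mod_cast h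
  exact ⟨by linarith [(hx i).1], (hx i).2.trans_le h'⟩

lemma iUnion_box : ⋃ m, box n m = Set.univ := by
  refine Set.eq_univ_of_forall fun x => Set.mem_iUnion.2 ?_
  obtain ⟨m, hm⟩ := exists_nat_gt ‖x‖
  refine ⟨m, fun i => ?_⟩
  have h := (PiLp.norm_apply_le x i).trans_lt hm
  rw [Real.norm_eq_abs, abs_lt] at h
  exact ⟨h.1.le, h.2⟩

lemma box_subset_closedBall (m : ℕ) : ∃ R : ℝ, box n m ⊆ Metric.closedBall 0 R := by
  refine ⟨n * m, fun x hx => ?_⟩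
  rw [mem_closedBall_zero_iff]
  calc ‖x‖ ≤ ∑ i, ‖x i‖ := by
        rw [EuclideanSpace.norm_eq]
        exact Real.sqrt_le_iff.2 ⟨by positivity,
          Finset.sum_sq_le_sq_sum_of_nonneg fun i _ => norm_nonneg _⟩
    _ ≤ ∑ i : Fin n, (m : ℝ) := Finset.sum_le_sum fun i _ => by
        rw [Real.norm_eq_abs, abs_le]; exact ⟨(hx i).1, (hx i).2.le⟩
    _ = n * m := by simp

/-- The boxes `[-m, m)ⁿ` have partitions into cubes that are small compared with their volume. -/
lemma exists_partition_box (n : ℕ) (e : ℝ) (he : (n : ℝ) < e) (m : ℕ) {δ : ℝ≥0∞} (hδ : 0 < δ) :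
    ∃ (ι : Type) (_ : Fintype ι) (Q : ι → Set (EuclideanSpace ℝ (Fin n))) (v d : ℝ≥0∞),
      (∀ k, MeasurableSet (Q k)) ∧ Pairwise (Function.onFun Disjoint Q) ∧ ⋃ k, Q k = box n m ∧
      v ≠ 0 ∧ v ≠ ∞ ∧ d ≠ ∞ ∧ (∀ k, volume (Q k) = v) ∧ (∀ k, ∀ x ∈ Q k, ∀ y ∈ Q k, ‖x - y‖ₑ ≤ d) ∧
      v⁻¹ * d ^ e ≤ δ := by
  -- With side `1/N`, the volume is `N^(-n)` and the diameter at most `n/N`, so the quantity is `n^e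
  -- N^(n-e)`, which tends to 0.
  obtain ⟨N, hN0, hN⟩ : ∃ N : ℕ, 0 < N ∧
      (ENNReal.ofReal ((1 / N) ^ n))⁻¹ * (ENNReal.ofReal (n * (1 / N))) ^ e ≤ δ := by
    have h1 : Filter.Tendsto (fun N : ℕ => ENNReal.ofReal ((n : ℝ) ^ e * (N : ℝ) ^ (-(e - n))))
        Filter.atTop (nhds 0) := by
      have h2 := ((tendsto_rpow_neg_atTop (sub_pos.2 he)).comp
        (tendsto_natCast_atTop_atTop (R := ℝ))).const_mul ((n : ℝ) ^ e)
      simpa using ENNReal.tendsto_ofReal h2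
    obtain ⟨N, hN, hN0⟩ := ((h1.eventually_le_const hδ).and (Filter.eventually_gt_atTop 0)).exists
    refine ⟨N, hN0, le_trans (le_of_eq ?_) hN⟩
    have hN' : (0 : ℝ) < N := by exact_mod_cast hN0
    rw [← ENNReal.ofReal_inv_of_pos (by positivity),
      ENNReal.ofReal_rpow_of_nonneg (by positivity) (by linarith [n.cast_nonneg (α := ℝ)]),
      ← ENNReal.ofReal_mul (by positivity), Real.mul_rpow (by positivity) (by positivity),
      one_div, Real.inv_rpow hN'.le, inv_pow, inv_inv, neg_sub, Real.rpow_sub hN',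
      Real.rpow_natCast]
    congr 1
    ring
  have hN' : (0 : ℝ) < N := by exact_mod_cast hN0
  let a (k : Fin n → Fin (2 * m * N)) (i : Fin n) : ℝ := -m + (k i : ℕ) / N
  let b (k : Fin n → Fin (2 * m * N)) (i : Fin n) : ℝ := -m + ((k i : ℕ) + 1) / N
  have hab (k i) : b k i - a k i = 1 / N := by simp only [a, b]; ring
  -- The floor of `(t + m) N` is the index of the cube in that coordinate; disjointness and covering
  -- both follow.
  have hmem (k : Fin n → Fin (2 * m * N)) (i : Fin n) (t : ℝ) :
      t ∈ Set.Ico (a k i) (b k i) ↔ -(m : ℝ) ≤ t ∧ ⌊(t + m) * N⌋₊ = (k i : ℕ) := by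
    have h1 : t ∈ Set.Ico (a k i) (b k i) ↔
        ((k i : ℕ) : ℝ) ≤ (t + m) * N ∧ (t + m) * N < (k i : ℕ) + 1 := by
      rw [Set.mem_Ico, ← div_le_iff₀ hN', ← lt_div_iff₀ hN']
      constructor <;> rintro ⟨h, h'⟩ <;> constructor <;> simp only [a, b] at * <;> linarith
    rw [h1]
    constructor
    · intro h
      have h0 : 0 ≤ (t + m) * N := h.1.trans' (by positivity)
      exact ⟨by linarith [nonneg_of_mul_nonneg_left h0 hN'], (Nat.floor_eq_iff h0).2 h⟩
    · rintro ⟨h, h'⟩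
      exact (Nat.floor_eq_iff (mul_nonneg (by linarith) hN'.le)).1 h'
  refine ⟨Fin n → Fin (2 * m * N), inferInstance,
    fun k => {x | ∀ i, x i ∈ Set.Ico (a k i) (b k i)}, ENNReal.ofReal ((1 / N) ^ n),
    ENNReal.ofReal (n * (1 / N)), fun k => measurableSet_setOf_mem_Ico _ _, ?_, ?_, ?_,
    ENNReal.ofReal_ne_top, ENNReal.ofReal_ne_top, fun k => ?_, ?_, hN⟩
  · intro k l hkl
    refine Set.disjoint_left.2 fun x hx hx' => hkl ?_
    ext i
    exact ((hmem k i _).1 (hx i)).2.symm.trans ((hmem l i _).1 (hx' i)).2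
  · ext x
    simp only [Set.mem_iUnion, Set.mem_ofPred_eq, hmem]
    constructor
    · rintro ⟨k, hk⟩ i
      refine ⟨(hk i).1, ?_⟩
      have h1 := Nat.lt_of_floor_lt (((hk i).2.symm ▸ (k i).2 : ⌊(x i + m) * N⌋₊ < 2 * m * N))
      push_cast at h1
      have := lt_of_mul_lt_mul_right h1 hN'.le
      linarith
    · intro hx
      have h1 (i : Fin n) : ⌊(x i + m) * N⌋₊ < 2 * m * N := by
        rw [Nat.floor_lt (mul_nonneg (by linarith [(hx i).1]) hN'.le)]
        push_cast
        exact mul_lt_mul_of_pos_right (by linarith [(hx i).2]) hN'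
      exact ⟨fun i => ⟨_, h1 i⟩, fun i => ⟨(hx i).1, rfl⟩⟩
  · have : (0 : ℝ) < (1 / N) ^ n := by positivity
    simpa only [Ne, ENNReal.ofReal_eq_zero, not_le] using this
  · rw [volume_setOf_mem_Ico]
    simp only [hab]
    rw [Finset.prod_const, Finset.card_univ, Fintype.card_fin,
      ENNReal.ofReal_pow (by positivity)]
  · intro k x hx y hy
    rw [← ofReal_norm]
    refine ENNReal.ofReal_le_ofReal ?_
    calc ‖x - y‖ ≤ ∑ i, ‖(x - y) i‖ := by
          rw [EuclideanSpace.norm_eq]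
          exact Real.sqrt_le_iff.2 ⟨by positivity,
            Finset.sum_sq_le_sq_sum_of_nonneg fun i _ => norm_nonneg _⟩
      _ ≤ ∑ i : Fin n, (1 / N : ℝ) := Finset.sum_le_sum fun i _ => by
          rw [← hab k i, Real.norm_eq_abs, PiLp.sub_apply, abs_le]
          have h1 := hx i
          have h2 := hy i
          constructor <;> linarith [h1.1, h1.2, h2.1, h2.2]
      _ = n * (1 / N) := by simp

end Partition

/-! ### Averaging over cubes and its error in L^p and L^q. -/

section StepApproximation

variable {n : ℕ} {ι : Type*} [Fintype ι]

/-- The function that equals, on each set `Q k`, the average of `u` over `Q k`. -/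
noncomputable def stepApprox (Q : ι → Set (EuclideanSpace ℝ (Fin n)))
    (u : EuclideanSpace ℝ (Fin n) → ℝ) (x : EuclideanSpace ℝ (Fin n)) : ℝ :=
  ∑ k, (Q k).indicator (fun _ => ⨍ y in Q k, u y) x

variable {Q : ι → Set (EuclideanSpace ℝ (Fin n))} {u : EuclideanSpace ℝ (Fin n) → ℝ}

lemma stepApprox_of_mem (hQ : Pairwise (Function.onFun Disjoint Q)) {k : ι}
    {x : EuclideanSpace ℝ (Fin n)} (hx : x ∈ Q k) : stepApprox Q u x = ⨍ y in Q k, u y := by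
  rw [stepApprox, Finset.sum_eq_single k, Set.indicator_of_mem hx]
  · intro l _ hl
    exact Set.indicator_of_notMem (fun h => Set.disjoint_left.1 (hQ hl) h hx) _
  · simp

lemma stepApprox_of_notMem {x : EuclideanSpace ℝ (Fin n)} (hx : x ∉ ⋃ k, Q k) :
    stepApprox Q u x = 0 :=
  Finset.sum_eq_zero fun k _ =>
    Set.indicator_of_notMem (fun h => hx (Set.mem_iUnion_of_mem k h)) _

lemma measurable_stepApprox (hm : ∀ k, MeasurableSet (Q k)) : Measurable (stepApprox Q u) := by
  unfold stepApprox
  exact Finset.measurable_sum _ fun k _ => measurable_const.indicator (hm k)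

variable {v : ℝ≥0∞}

/-- Jensen on each cube. -/
lemma setLIntegral_sub_stepApprox_le (hm : ∀ k, MeasurableSet (Q k))
    (hQ : Pairwise (Function.onFun Disjoint Q)) (hv0 : v ≠ 0) (hvt : v ≠ ∞)
    (hv : ∀ k, volume (Q k) = v) (hu : Continuous u) (hc : HasCompactSupport u) {a : ℝ}
    (ha : 1 ≤ a) :
    ∫⁻ x in ⋃ k, Q k, ‖u x - stepApprox Q u x‖ₑ ^ a ≤
      ∑ k, v⁻¹ * ∫⁻ x in Q k, ∫⁻ y in Q k, ‖u x - u y‖ₑ ^ a := by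
  rw [lintegral_iUnion hm hQ, tsum_fintype]
  refine Finset.sum_le_sum fun k _ => ?_
  rw [← lintegral_const_mul' _ _ (ENNReal.inv_ne_top.2 hv0)]
  refine setLIntegral_mono' (hm k) fun x hx => ?_
  rw [stepApprox_of_mem hQ hx]
  have : IsFiniteMeasure (volume.restrict (Q k)) := ⟨by simp [hv, hvt.lt_top]⟩
  have h := enorm_sub_average_rpow_le (μ := volume.restrict (Q k)) ha
    (by rw [Ne, Measure.restrict_eq_zero, hv]; exact hv0)
    (hu.integrable_of_hasCompactSupport hc).restrict (u x)
  simpa only [Measure.restrict_apply_univ, hv] using h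

/-- Two points of one cube are at distance at most d, so the kernel is at least `d^(-(n+sp))` there.
The factor `v⁻¹ d^(n+sp)` is the one that `exists_partition_box` makes small. -/
lemma setLIntegral_sub_stepApprox_le_gagliardo (hm : ∀ k, MeasurableSet (Q k))
    (hQ : Pairwise (Function.onFun Disjoint Q)) (hv0 : v ≠ 0) (hvt : v ≠ ∞)
    (hv : ∀ k, volume (Q k) = v) (hu : Continuous u) (hc : HasCompactSupport u) {s p : ℝ}
    (hs : 0 < s) (hp : 1 ≤ p) {d : ℝ≥0∞} (hdt : d ≠ ∞)
    (hd : ∀ k, ∀ x ∈ Q k, ∀ y ∈ Q k, ‖x - y‖ₑ ≤ d) :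
    ∫⁻ x in ⋃ k, Q k, ‖u x - stepApprox Q u x‖ₑ ^ p ≤
      v⁻¹ * d ^ ((n : ℝ) + s * p) * gagliardo n s p u ^ p := by
  refine (setLIntegral_sub_stepApprox_le hm hQ hv0 hvt hv hu hc hp).trans ?_
  have hp0 : 0 < p := by linarith
  have hdt' : d ^ ((n : ℝ) + s * p) ≠ ∞ := ENNReal.rpow_ne_top_of_nonneg (by positivity) hdt
  calc _ ≤ ∑ k, v⁻¹ * (d ^ ((n : ℝ) + s * p) * ∫⁻ x in Q k, gagliardoInner n s p u x) := by
        refine Finset.sum_le_sum fun k _ => ?_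
        rw [← lintegral_const_mul' _ _ hdt']
        refine mul_le_mul_right (setLIntegral_mono' (hm k) fun x hx => ?_) _
        refine (setLIntegral_enorm_sub_rpow_le hs hp0 (hm k) (hd k x hx) hu).trans ?_
        gcongr
        exact setLIntegral_le_lintegral _ _
    _ = v⁻¹ * d ^ ((n : ℝ) + s * p) * ∫⁻ x in ⋃ k, Q k, gagliardoInner n s p u x := by
        rw [lintegral_iUnion hm hQ, tsum_fintype, Finset.mul_sum]
        simp only [mul_assoc]
    _ ≤ _ := by
        rw [← lintegral_gagliardoInner hp0 hu]
        gcongr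
        exact Measure.restrict_le_self

/-- The other endpoint of the interpolation, where boundedness suffices. -/
lemma setLIntegral_sub_stepApprox_le_lintegral (hm : ∀ k, MeasurableSet (Q k))
    (hQ : Pairwise (Function.onFun Disjoint Q)) (hv0 : v ≠ 0) (hvt : v ≠ ∞)
    (hv : ∀ k, volume (Q k) = v) (hu : Continuous u) (hc : HasCompactSupport u) {q : ℝ}
    (hq : 1 ≤ q) :
    ∫⁻ x in ⋃ k, Q k, ‖u x - stepApprox Q u x‖ₑ ^ q ≤ 2 ^ q * ∫⁻ x in ⋃ k, Q k, ‖u x‖ₑ ^ q := by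
  refine (setLIntegral_sub_stepApprox_le hm hQ hv0 hvt hv hu hc hq).trans ?_
  have hmu := hu.measurable
  rw [lintegral_iUnion hm hQ, tsum_fintype, Finset.mul_sum]
  refine Finset.sum_le_sum fun k _ => ?_
  set I := ∫⁻ x in Q k, ‖u x‖ₑ ^ q
  calc v⁻¹ * ∫⁻ x in Q k, ∫⁻ y in Q k, ‖u x - u y‖ₑ ^ q
      ≤ v⁻¹ * ∫⁻ x in Q k, ∫⁻ y in Q k, 2 ^ (q - 1) * (‖u x‖ₑ ^ q + ‖u y‖ₑ ^ q) := by
        gcongr with x y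
        calc ‖u x - u y‖ₑ ^ q ≤ (‖u x‖ₑ + ‖u y‖ₑ) ^ q := by gcongr; exact enorm_sub_le
          _ ≤ _ := by
            rw [mul_add]
            simpa [mul_add] using ENNReal.rpow_add_le_mul_rpow_add_rpow ‖u x‖ₑ ‖u y‖ₑ hq
    _ = v⁻¹ * ∫⁻ x in Q k, (2 ^ (q - 1) * v * ‖u x‖ₑ ^ q + 2 ^ (q - 1) * I) := by
        congr 1
        refine lintegral_congr fun x => ?_
        rw [lintegral_const_mul _ (by fun_prop), lintegral_add_left (by fun_prop),
          setLIntegral_const, hv]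
        ring
    _ = v⁻¹ * v * (2 ^ (q - 1) * 2 * I) := by
        rw [lintegral_add_left (by fun_prop), lintegral_const_mul _ (by fun_prop),
          setLIntegral_const, hv]
        ring
    _ = 2 ^ q * I := by
        rw [ENNReal.inv_mul_cancel hv0 hvt, one_mul]
        nth_rewrite 2 [← ENNReal.rpow_one 2]
        rw [← ENNReal.rpow_add _ _ (by simp) (by simp), sub_add_cancel]

end StepApproximation

/-! ### Hölder's inequality and weighted measures. -/

section Weighted

open Filter Topology

lemma lintegral_rpow_mul_rpow_mul_rpow_le {α : Type*} [MeasurableSpace α] {μ : Measure α}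
    {f g h : α → ℝ≥0∞} (hf : AEMeasurable f μ) (hg : AEMeasurable g μ) (hh : AEMeasurable h μ)
    {a b c : ℝ} (ha : 0 ≤ a) (hb : 0 ≤ b) (hc : 0 ≤ c) (habc : a + b + c = 1) :
    ∫⁻ x, f x ^ a * g x ^ b * h x ^ c ∂μ ≤
      (∫⁻ x, f x ∂μ) ^ a * (∫⁻ x, g x ∂μ) ^ b * (∫⁻ x, h x ∂μ) ^ c := by
  have := ENNReal.lintegral_prod_norm_pow_le (μ := μ) Finset.univ (f := ![f, g, h])
    (p := ![a, b, c])
    (by intro i _; fin_cases i <;> assumption) (by simpa [Fin.sum_univ_three] using habc)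
    (by intro i _; fin_cases i <;> assumption)
  simpa [Fin.prod_univ_three] using this

variable {n : ℕ} {W : EuclideanSpace ℝ (Fin n) → ℝ}

lemma eLpNorm_weighted (hW : AEMeasurable W) {r : ℝ} (hr : 0 < r)
    {f : EuclideanSpace ℝ (Fin n) → ℝ} (hf : Measurable f) :
    eLpNorm f (ENNReal.ofReal r) (weighted n W) =
      (∫⁻ x, ENNReal.ofReal (W x) * ‖f x‖ₑ ^ r) ^ (1 / r) := by
  rw [eLpNorm_eq_lintegral_rpow_enorm_toReal (by simpa using hr) (by simp),
    ENNReal.toReal_ofReal hr.le, weighted,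
    lintegral_withDensity_eq_lintegral_mul₀ hW.ennreal_ofReal (by fun_prop)]
  rfl

lemma weighted_absolutelyContinuous : weighted n W ≪ volume :=
  withDensity_absolutelyContinuous _ _

lemma absolutelyContinuous_weighted (hW : AEMeasurable W) (hW0 : ∀ x, 0 < W x) :
    volume ≪ weighted n W :=
  withDensity_absolutelyContinuous' hW.ennreal_ofReal
    (Eventually.of_forall fun x => by simpa using hW0 x)

end Weighted

/-! ### Bounds by the norm, and its lower semicontinuity. -/

section PreMV

variable {n : ℕ} {s p q : ℝ} [hp : Fact (1 ≤ p)] [hq : Fact (1 ≤ q)]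
  {V : EuclideanSpace ℝ (Fin n) → ℝ}

lemma PreMV.continuous (u : PreMV n s p q V) : Continuous u.toFun := u.mem.1.continuous

lemma PreMV.eLpNorm_le (u : PreMV n s p q V) :
    eLpNorm u.toFun (ENNReal.ofReal q) (weighted n V) ≤ ENNReal.ofReal ‖u‖ := by
  rw [← ENNReal.ofReal_toReal u.mem.2.2.1.ne, u.norm_def]
  exact ENNReal.ofReal_le_ofReal (by simp)

lemma PreMV.gagliardo_le (u : PreMV n s p q V) :
    gagliardo n s p u.toFun ≤ ENNReal.ofReal ‖u‖ := by
  rw [← ENNReal.ofReal_toReal u.mem.2.2.2.ne, u.norm_def]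
  exact ENNReal.ofReal_le_ofReal (by simp)

lemma PreMV.lintegral_le (hV : AEMeasurable V) (u : PreMV n s p q V) :
    ∫⁻ x, ENNReal.ofReal (V x) * ‖u.toFun x‖ₑ ^ q ≤ ENNReal.ofReal ‖u‖ ^ q := by
  have hq0 : 0 < q := by linarith [hq.out]
  have h := u.eLpNorm_le
  rwa [eLpNorm_weighted hV hq0 u.continuous.measurable, one_div, ENNReal.rpow_inv_le_iff hq0] at h

/-- Fatou for each of the two terms, the Gagliardo seminorm being an L^p norm on the product space.
Each term is at most ε, hence the factor 2. -/
lemma PreMV.norm_le_of_tendsto {u : ℕ → PreMV n s p q V}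
    {v : PreMV n s p q V} {ε : ℝ} (hu : ∀ k, ‖u k‖ ≤ ε)
    (hlim : ∀ᵐ x, Filter.Tendsto (fun k => (u k).toFun x) Filter.atTop (nhds (v.toFun x))) :
    ‖v‖ ≤ 2 * ε := by
  have hp0 : 0 < p := by linarith [hp.out]
  have hε : 0 ≤ ε := (norm_nonneg _).trans (hu 0)
  have h1 : eLpNorm v.toFun (ENNReal.ofReal q) (weighted n V) ≤ ENNReal.ofReal ε :=
    Lp.eLpNorm_le_of_ae_tendsto (u := Filter.atTop) (f := fun k => (u k).toFun)
      (Filter.Eventually.of_forall fun k => (u k).eLpNorm_le.trans (ENNReal.ofReal_le_ofReal (hu k)))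
      (fun k => (u k).continuous.aestronglyMeasurable)
      (weighted_absolutelyContinuous.ae_le hlim)
  have hg (w : PreMV n s p q V) : gagliardo n s p w.toFun =
      eLpNorm (fun z : EuclideanSpace ℝ (Fin n) × EuclideanSpace ℝ (Fin n) =>
        w.toFun z.1 - w.toFun z.2) (ENNReal.ofReal p)
        (volume.withDensity fun z => (‖z.1 - z.2‖ₑ ^ ((n : ℝ) + s * p))⁻¹) := by
    rw [gagliardo_eq n s p w.continuous,
      eLpNorm_eq_lintegral_rpow_enorm_toReal (by simpa using hp0) (by simp),
      ENNReal.toReal_ofReal hp0.le]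
  have hlim2 : ∀ᵐ z : EuclideanSpace ℝ (Fin n) × EuclideanSpace ℝ (Fin n), Filter.Tendsto
      (fun k => (u k).toFun z.1 - (u k).toFun z.2) Filter.atTop
      (nhds (v.toFun z.1 - v.toFun z.2)) := by
    filter_upwards [Measure.quasiMeasurePreserving_fst.ae hlim,
      Measure.quasiMeasurePreserving_snd.ae hlim] with z h1 h2
    exact h1.sub h2
  have h2 : gagliardo n s p v.toFun ≤ ENNReal.ofReal ε := by
    rw [hg]
    refine Lp.eLpNorm_le_of_ae_tendsto (u := Filter.atTop)
      (f := fun k (z : EuclideanSpace ℝ (Fin n) × EuclideanSpace ℝ (Fin n)) =>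
        (u k).toFun z.1 - (u k).toFun z.2)
      (Filter.Eventually.of_forall fun k => ?_) (fun k => ?_)
      ((withDensity_absolutelyContinuous _ _).ae_le hlim2)
    · rw [← hg]
      exact (u k).gagliardo_le.trans (ENNReal.ofReal_le_ofReal (hu k))
    · have := (u k).continuous
      exact Continuous.aestronglyMeasurable (by fun_prop)
  rw [v.norm_def]
  linarith [ENNReal.toReal_le_of_le_ofReal hε h1, ENNReal.toReal_le_of_le_ofReal hε h2]

end PreMV

/-! ### The weighted embedding inequality and local interpolation. -/

section Estimates

variable {n : ℕ} {s p q r : ℝ} {K V : EuclideanSpace ℝ (Fin n) → ℝ}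

/-- These make `1 - (1+τ)/Ψ`, `τ/Ψ`, `1/Ψ` admissible Hölder exponents that produce `|u|^r`. At `τ =
r/(q-r)` the first one vanishes. -/
lemma psi_properties {P τ : ℝ} (hP : 0 < P) (hr : P ≤ r) (hrq : r < q) (hτ : r / (q - r) ≤ τ)
    (hτr : r = P → τ = r / (q - r)) :
    0 < τ ∧ 1 + τ ≤ psi P q r τ ∧
      P * (1 - (1 + τ) / psi P q r τ) + q * (τ / psi P q r τ) = r := by
  have hqr : 0 < q - r := by linarith
  have hτ0 : 0 < τ := lt_of_lt_of_le (div_pos (by linarith) hqr) hτ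
  refine ⟨hτ0, ?_⟩
  by_cases h : r = P
  · have h1 : 1 + τ = q / (q - r) := by rw [hτr h]; field_simp; ring
    rw [psi, if_pos h, h1]
    refine ⟨le_rfl, ?_⟩
    have hq0 : q ≠ 0 := by linarith
    rw [hτr h]
    field_simp
    ring
  · have hrP : 0 < r - P := lt_of_le_of_ne (by linarith) (by intro h'; exact h (by linarith))
    have h1 : r ≤ τ * (q - r) := (div_le_iff₀ hqr).1 hτ
    have h2 : psi P q r τ = (τ * (q - P) - P) / (r - P) := by
      rw [psi, if_neg h, ← neg_div_neg_eq]; congr 1 <;> ring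
    have h3 : 1 + τ ≤ psi P q r τ := by
      rw [h2, le_div_iff₀ hrP]; nlinarith
    refine ⟨h3, ?_⟩
    have h4 : psi P q r τ * (r - P) = τ * (q - P) - P := by
      rw [h2, div_mul_cancel₀ _ hrP.ne']
    have h5 : psi P q r τ ≠ 0 := by linarith
    field_simp
    linarith

/-- The weighted embedding inequality, localized to measurable sets. -/
lemma exists_setLIntegral_weight_le [Fact (1 ≤ p)] [Fact (1 ≤ q)] (hn : 0 < n) (hs : 0 < s)
    (hsp : s * p < n) (hr : critExp n s p ≤ r) (hrq : r < q)
    (hK : AEMeasurable K) (hV : AEMeasurable V) (hK0 : ∀ x, 0 < K x) (hV0 : ∀ x, 0 < V x)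
    {τ : ℝ} (hτ : r / (q - r) ≤ τ) (hτr : r = critExp n s p → τ = r / (q - r)) :
    ∃ (C : ℝ≥0∞) (w : ℝ), C ≠ ∞ ∧ 0 < w ∧ ∀ (S : Set (EuclideanSpace ℝ (Fin n)))
      (u : PreMV n s p q V),
      ∫⁻ x in S, ENNReal.ofReal (K x) * ‖u.toFun x‖ₑ ^ r ≤ C * ENNReal.ofReal ‖u‖ ^ r *
        (∫⁻ x in S, ENNReal.ofReal (K x ^ psi (critExp n s p) q r τ * V x ^ (-τ))) ^ w := by
  have hp : 1 ≤ p := Fact.out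
  obtain ⟨C, hC, hsob⟩ := lintegral_critExp_le hn hs hp hsp
  have hP0 := critExp_pos hn hp hsp
  obtain ⟨hτ0, hψ, hsum⟩ := psi_properties hP0 hr hrq hτ hτr
  set P := critExp n s p
  set Ψ := psi P q r τ
  have hΨ0 : 0 < Ψ := by linarith
  have hr0 : 0 < r := by linarith
  have hq0 : 0 < q := by linarith
  have ha : 0 ≤ 1 - (1 + τ) / Ψ := by rw [sub_nonneg, div_le_one hΨ0]; exact hψ
  set a := 1 - (1 + τ) / Ψ with ha'
  have hb : 0 ≤ τ / Ψ := by positivity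
  refine ⟨C ^ a, 1 / Ψ, ENNReal.rpow_ne_top_of_nonneg ha hC, by positivity, fun S u => ?_⟩
  have hmu := u.continuous.measurable
  -- The powers of V cancel, K keeps the power one, and the powers of `|u|` add up to r.
  have hpt (x) : ENNReal.ofReal (K x) * ‖u.toFun x‖ₑ ^ r = (‖u.toFun x‖ₑ ^ P) ^ a *
      (ENNReal.ofReal (V x) * ‖u.toFun x‖ₑ ^ q) ^ (τ / Ψ) *
      ENNReal.ofReal (K x ^ Ψ * V x ^ (-τ)) ^ (1 / Ψ) := by
    have hKx := hK0 x
    have hVx := hV0 x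
    rw [ENNReal.mul_rpow_of_nonneg _ _ hb, ← ENNReal.rpow_mul, ← ENNReal.rpow_mul,
      ENNReal.ofReal_rpow_of_pos hVx, ENNReal.ofReal_rpow_of_pos (by positivity),
      Real.mul_rpow (by positivity) (by positivity), ← Real.rpow_mul hKx.le,
      ← Real.rpow_mul hVx.le, mul_one_div_cancel hΨ0.ne', Real.rpow_one]
    have h1 : ENNReal.ofReal (V x ^ (τ / Ψ)) * ENNReal.ofReal (K x * V x ^ (-τ * (1 / Ψ))) =
        ENNReal.ofReal (K x) := by
      rw [← ENNReal.ofReal_mul (by positivity), mul_left_comm, ← Real.rpow_add hVx,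
        show τ / Ψ + -τ * (1 / Ψ) = 0 by ring, Real.rpow_zero, mul_one]
    conv_lhs => rw [← h1, ← hsum, ENNReal.rpow_add_of_nonneg _ _ (by positivity) (by positivity)]
    ring
  simp only [hpt]
  have hKm : AEMeasurable (fun x => ENNReal.ofReal (K x ^ Ψ * V x ^ (-τ))) :=
    ((hK.pow_const _).mul (hV.pow_const _)).ennreal_ofReal
  have hVm : AEMeasurable (fun x => ENNReal.ofReal (V x) * ‖u.toFun x‖ₑ ^ q) :=
    hV.ennreal_ofReal.mul (by fun_prop)
  refine (lintegral_rpow_mul_rpow_mul_rpow_le (by fun_prop) hVm.restrict hKm.restrict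
    ha hb (by positivity) (by rw [ha']; field_simp; ring)).trans ?_
  refine mul_le_mul_left ?_ _
  calc _ ≤ (C * ENNReal.ofReal ‖u‖ ^ P) ^ a * (ENNReal.ofReal ‖u‖ ^ q) ^ (τ / Ψ) := by
        gcongr
        · refine (setLIntegral_le_lintegral _ _).trans
            ((hsob _ u.continuous u.mem.2.1).trans ?_)
          gcongr
          exact u.gagliardo_le
        · exact (setLIntegral_le_lintegral _ _).trans (u.lintegral_le hV)
    _ = _ := by
      rw [ENNReal.mul_rpow_of_nonneg _ _ ha, ← ENNReal.rpow_mul, ← ENNReal.rpow_mul, mul_assoc,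
        ← ENNReal.rpow_add_of_nonneg _ _ (by positivity) (by positivity), hsum]

/-- Interpolation between `L^p` and `L^q` for the weight `K ∈ L^t`, `t > q / (q - r)`. -/
lemma exists_lintegral_weight_le_interpolation {α : Type*} [MeasurableSpace α] {μ : Measure α}
    [IsFiniteMeasure μ] {K : α → ℝ} (hp : 0 < p) (hpr : p < r) (hrq : r < q)
    (hK0 : ∀ x, 0 < K x) {t : ℝ≥0∞}
    (ht : ENNReal.ofReal (q / (q - r)) < t) (hK : MemLp K t μ) :
    ∃ (C : ℝ≥0∞) (a b : ℝ), C ≠ ∞ ∧ 0 < a ∧ 0 ≤ b ∧ p * a + q * b = r ∧ ∀ w : α → ℝ,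
      Measurable w → ∫⁻ x, ENNReal.ofReal (K x) * ‖w x‖ₑ ^ r ∂μ ≤
        C * (∫⁻ x, ‖w x‖ₑ ^ p ∂μ) ^ a * (∫⁻ x, ‖w x‖ₑ ^ q ∂μ) ^ b := by
  -- A finite exponent strictly between `q/(q-r)` and t also covers `t = ∞`, since the measure is
  -- finite.
  obtain ⟨c, hc1, hc2⟩ := ENNReal.lt_iff_exists_nnreal_btwn.1 ht
  have hqr : 0 < q - r := by linarith
  have hq0 : 0 < q := by linarith
  have hqp : 0 < q - p := by linarith
  have hc : q / (q - r) < c := by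
    rw [← ENNReal.ofReal_coe_nnreal] at hc1
    exact (ENNReal.ofReal_lt_ofReal_iff_of_nonneg (by positivity)).1 hc1
  have hc0 : (0 : ℝ) < c := lt_trans (by positivity) hc
  have hKc := hK.mono_exponent hc2.le
  have hI : ∫⁻ x, ENNReal.ofReal (K x) ^ (c : ℝ) ∂μ < ∞ := by
    have := lintegral_rpow_enorm_lt_top_of_eLpNorm_lt_top (by simpa using hc0.ne')
      ENNReal.coe_ne_top hKc.2
    refine lt_of_le_of_lt (le_of_eq (lintegral_congr fun x => ?_)) this
    rw [Real.enorm_of_nonneg (hK0 x).le, ENNReal.coe_toReal]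
  have hcr : q / c < q - r := by
    rw [div_lt_iff₀ hqr] at hc
    rw [div_lt_iff₀ hc0]; linarith
  -- Solves `a + b + 1/c = 1` and `pa + qb = r`. The strict bound on c gives `a > 0`, so smallness
  -- in L^p is inherited.
  set a := (q - r - q / c) / (q - p) with ha'
  have ha : 0 < a := div_pos (by linarith) hqp
  have ha1 : a ≤ 1 := by
    rw [ha', div_le_one hqp]
    have : 0 < q / c := by positivity
    linarith
  have haq : a * (q - p) = q - r - q / c := by rw [ha', div_mul_cancel₀ _ hqp.ne']
  set b := (r - p * a) / q with hb'
  have hb : 0 ≤ b := div_nonneg (by nlinarith) hq0.le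
  have hsum : p * a + q * b = r := by rw [hb']; field_simp; ring
  refine ⟨(∫⁻ x, ENNReal.ofReal (K x) ^ (c : ℝ) ∂μ) ^ (1 / (c : ℝ)), a, b,
    ENNReal.rpow_ne_top_of_nonneg (by positivity) hI.ne, ha, hb, hsum, fun w hw => ?_⟩
  have hpt (x) : ENNReal.ofReal (K x) * ‖w x‖ₑ ^ r =
      (‖w x‖ₑ ^ p) ^ a * (‖w x‖ₑ ^ q) ^ b * (ENNReal.ofReal (K x) ^ (c : ℝ)) ^ (1 / (c : ℝ)) := by
    rw [← ENNReal.rpow_mul, ← ENNReal.rpow_mul, ← ENNReal.rpow_mul, mul_one_div_cancel hc0.ne',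
      ENNReal.rpow_one, ← ENNReal.rpow_add_of_nonneg _ _ (by positivity) (by positivity), hsum,
      mul_comm]
  simp only [hpt]
  refine (lintegral_rpow_mul_rpow_mul_rpow_le (by fun_prop) (by fun_prop)
    (hK.1.aemeasurable.ennreal_ofReal.pow_const _) ha.le hb (by positivity) ?_).trans ?_
  · have h1 : q * (a + b + 1 / c) = q := by
      have : q * b = r - p * a := by linarith
      rw [mul_add, mul_add, this, mul_one_div]; linarith
    exact mul_left_cancel₀ hq0.ne' (by linarith)
  · rw [mul_comm _ (_ ^ (1 / (c : ℝ))), mul_assoc]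

end Estimates

/-! ### Uniform approximation by step functions in L^r(K). -/

section Approximation

open Filter Topology

variable {n : ℕ} {s p q r : ℝ} {K V : EuclideanSpace ℝ (Fin n) → ℝ}

lemma tendsto_const_mul_rpow {C : ℝ≥0∞} (hC : C ≠ ∞) {a : ℝ} (ha : 0 < a) :
    Tendsto (fun x : ℝ≥0∞ => C * x ^ a) (𝓝 0) (𝓝 0) := by
  have h := (ENNReal.continuous_rpow_const (y := a)).tendsto 0
  rw [ENNReal.zero_rpow_of_pos ha] at h
  simpa using ENNReal.Tendsto.const_mul h (Or.inr hC)

lemma tendsto_setLIntegral_compl_box {g : EuclideanSpace ℝ (Fin n) → ℝ≥0∞}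
    (hg : ∫⁻ x, g x ≠ ∞) :
    Tendsto (fun m => ∫⁻ x in (box n m)ᶜ, g x) atTop (𝓝 0) := by
  have h := tendsto_measure_iInter_atTop (μ := volume.withDensity g)
    (s := fun m => (box n m)ᶜ) (fun m => (measurableSet_box m).compl.nullMeasurableSet)
    (fun a b h => Set.compl_subset_compl.2 (box_mono h)) ⟨0, ?_⟩
  · rw [← Set.compl_iUnion, iUnion_box, Set.compl_univ, measure_empty] at h
    simpa only [Function.comp_def, withDensity_apply _ (measurableSet_box _).compl] using h
  · rw [withDensity_apply _ (measurableSet_box _).compl]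
    exact ((setLIntegral_le_lintegral _ _).trans_lt hg.lt_top).ne

/-- Step functions on a fixed finite family of cubes approximate test functions in `L^r(K)`,
uniformly on bounded sets. -/
lemma exists_stepApprox_weight_le [Fact (1 ≤ p)] [Fact (1 ≤ q)] (hn : 0 < n) (hs : 0 < s)
    (hsp : s * p < n) (hr : critExp n s p ≤ r) (hrq : r < q)
    (hK : AEMeasurable K) (hV : AEMeasurable V) (hK0 : ∀ x, 0 < K x) (hV0 : ∀ x, 0 < V x)
    (hVloc : ∀ D : Set (EuclideanSpace ℝ (Fin n)), IsCompact D → ∃ c : ℝ, 0 < c ∧ ∀ x ∈ D, c ≤ V x)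
    {t : ℝ≥0∞} (ht : ENNReal.ofReal (q / (q - r)) < t)
    (hKloc : ∀ D : Set (EuclideanSpace ℝ (Fin n)), IsCompact D → MemLp K t (volume.restrict D))
    {τ : ℝ} (hτ : r / (q - r) ≤ τ) (hτr : r = critExp n s p → τ = r / (q - r))
    (hKV : Integrable fun x => K x ^ psi (critExp n s p) q r τ * V x ^ (-τ))
    {ε : ℝ} (hε : 0 < ε) :
    ∃ (ι : Type) (_ : Fintype ι) (Q : ι → Set (EuclideanSpace ℝ (Fin n))) (D : Set _),
      IsCompact D ∧ (∀ k, Q k ⊆ D) ∧ (∀ k, MeasurableSet (Q k)) ∧ ∀ u : PreMV n s p q V,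
      ∫⁻ x, ENNReal.ofReal (K x) * ‖u.toFun x - stepApprox Q u.toFun x‖ₑ ^ r ≤
        ENNReal.ofReal (ε * ‖u‖) ^ r := by
  have hp : 1 ≤ p := Fact.out
  have hp0 : 0 < p := by linarith
  have hpr : p < r := (lt_critExp hn hs hp hsp).trans_le hr
  have hr0 : 0 < r := by linarith
  have hq0 : 0 < q := by linarith
  -- One half of the error for the box and one for its complement.
  obtain ⟨η, hη⟩ : ∃ η, η = ENNReal.ofReal ε ^ r / 2 := ⟨_, rfl⟩
  have hη0 : 0 < η := by
    rw [hη]; exact ENNReal.half_pos (by simp [hε])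
  obtain ⟨C₁, w, hC₁, hw, htail⟩ := exists_setLIntegral_weight_le hn hs hsp hr hrq hK hV hK0 hV0
    hτ hτr
  have hg : ∫⁻ x, ENNReal.ofReal (K x ^ psi (critExp n s p) q r τ * V x ^ (-τ)) ≠ ∞ :=
    hKV.lintegral_lt_top.ne
  obtain ⟨m, hm⟩ := (((tendsto_const_mul_rpow hC₁ hw).comp
    (tendsto_setLIntegral_compl_box hg)).eventually_le_const hη0).exists
  obtain ⟨R, hR⟩ := box_subset_closedBall (n := n) m
  have hD := isCompact_closedBall (0 : EuclideanSpace ℝ (Fin n)) R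
  obtain ⟨c, hc, hcV⟩ := hVloc _ hD
  have : IsFiniteMeasure (volume.restrict (box n m)) :=
    ⟨by simpa using (measure_mono hR).trans_lt hD.measure_lt_top⟩
  obtain ⟨C₂, a, b, hC₂, ha, hb, hab, hint⟩ :=
    exists_lintegral_weight_le_interpolation (μ := volume.restrict (box n m)) hp0 hpr hrq hK0 ht
      ((hKloc _ hD).mono_measure (Measure.restrict_mono hR le_rfl))
  set C₃ := C₂ * (2 ^ q * (ENNReal.ofReal c)⁻¹) ^ b
  have hC₃ : C₃ ≠ ∞ := ENNReal.mul_ne_top hC₂ (ENNReal.rpow_ne_top_of_nonneg hb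
    (ENNReal.mul_ne_top (by simp) (by simpa using hc)))
  -- The cubes are refined only after the box is fixed, since `C₃` depends on K and the lower bound
  -- of V near it.
  obtain ⟨δ, hδ, hδ0⟩ := (((tendsto_const_mul_rpow hC₃ ha).mono_left
    nhdsWithin_le_nhds).eventually_le_const hη0 |>.and
      (self_mem_nhdsWithin (s := Set.Ioi (0 : ℝ≥0∞)))).exists
  obtain ⟨ι, hι, Q, v, d, hQm, hQ, hQU, hv0, hvt, hdt, hv, hd, hδ'⟩ :=
    exists_partition_box n (n + s * p) (by nlinarith) m hδ0
  refine ⟨ι, hι, Q, Metric.closedBall 0 R, hD,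
    fun k => (Set.subset_iUnion Q k).trans (hQU ▸ hR), hQm, fun u => ?_⟩
  set N := ENNReal.ofReal ‖u‖
  have hmu := u.continuous.measurable
  have hloc : ∫⁻ x in box n m, ENNReal.ofReal (K x) * ‖u.toFun x - stepApprox Q u.toFun x‖ₑ ^ r ≤
      η * N ^ r := by
    have h1 := setLIntegral_sub_stepApprox_le_gagliardo hQm hQ hv0 hvt hv u.continuous u.mem.2.1
      hs hp hdt hd
    have h2 := setLIntegral_sub_stepApprox_le_lintegral hQm hQ hv0 hvt hv u.continuous u.mem.2.1
      (q := q) Fact.out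
    have h3 : ∫⁻ x in box n m, ‖u.toFun x‖ₑ ^ q ≤ (ENNReal.ofReal c)⁻¹ * N ^ q := by
      rw [← ENNReal.div_eq_inv_mul, ENNReal.le_div_iff_mul_le (by simp [hc]) (by simp), mul_comm,
        ← lintegral_const_mul _ (by fun_prop)]
      refine le_trans ?_ (u.lintegral_le hV)
      refine (setLIntegral_mono' (measurableSet_box m) fun x hx => ?_).trans
        (setLIntegral_le_lintegral _ _)
      gcongr
      exact hcV x (hR hx)
    rw [hQU] at h1 h2
    calc _ ≤ C₂ * (∫⁻ x in box n m, ‖u.toFun x - stepApprox Q u.toFun x‖ₑ ^ p) ^ a *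
          (∫⁻ x in box n m, ‖u.toFun x - stepApprox Q u.toFun x‖ₑ ^ q) ^ b :=
          hint _ (hmu.sub (measurable_stepApprox hQm))
      _ ≤ C₂ * (δ * N ^ p) ^ a * (2 ^ q * ((ENNReal.ofReal c)⁻¹ * N ^ q)) ^ b := by
          gcongr
          · refine h1.trans ?_
            gcongr
            exact u.gagliardo_le
          · exact h2.trans (by gcongr)
      _ = C₃ * δ ^ a * N ^ r := by
          rw [← mul_assoc (2 ^ q), ENNReal.mul_rpow_of_nonneg _ _ ha.le,
            ENNReal.mul_rpow_of_nonneg _ (N ^ q) hb, ← ENNReal.rpow_mul N, ← ENNReal.rpow_mul N,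
            ← hab, ENNReal.rpow_add_of_nonneg _ _ (by positivity) (by positivity)]
          ring
      _ ≤ _ := by gcongr
  -- Outside the box the step function is 0, so the error is the tail of u itself.
  have hcompl : ∫⁻ x in (box n m)ᶜ,
      ENNReal.ofReal (K x) * ‖u.toFun x - stepApprox Q u.toFun x‖ₑ ^ r ≤ η * N ^ r := by
    calc _ = ∫⁻ x in (box n m)ᶜ, ENNReal.ofReal (K x) * ‖u.toFun x‖ₑ ^ r :=
          setLIntegral_congr_fun (measurableSet_box m).compl fun x hx => by
            simp only [stepApprox_of_notMem (hQU ▸ hx : x ∉ ⋃ k, Q k), sub_zero]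
      _ ≤ _ := htail _ u
      _ = C₁ * (∫⁻ x in (box n m)ᶜ, ENNReal.ofReal
            (K x ^ psi (critExp n s p) q r τ * V x ^ (-τ))) ^ w * N ^ r := by ring
      _ ≤ _ := by gcongr; exact hm
  rw [← lintegral_add_compl _ (measurableSet_box m)]
  calc _ ≤ η * N ^ r + η * N ^ r := add_le_add hloc hcompl
    _ = _ := by
      rw [← add_mul, hη, ENNReal.add_halves, ENNReal.ofReal_mul hε.le,
        ENNReal.mul_rpow_of_nonneg _ _ hr0.le]

end Approximation

/-! ### The inclusion, its finite-rank approximants, and injectivity. -/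

section Embedding

open Filter Topology

variable {n : ℕ} {s p q r : ℝ} [Fact (1 ≤ p)] [Fact (1 ≤ q)] [Fact (1 ≤ r)]
  {K V : EuclideanSpace ℝ (Fin n) → ℝ}

lemma eLpNorm_weighted_le_iff (hK : AEMeasurable K) {f : EuclideanSpace ℝ (Fin n) → ℝ}
    (hf : Measurable f) (B : ℝ≥0∞) :
    eLpNorm f (ENNReal.ofReal r) (weighted n K) ≤ B ↔
      ∫⁻ x, ENNReal.ofReal (K x) * ‖f x‖ₑ ^ r ≤ B ^ r := by
  have hr : 1 ≤ r := Fact.out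
  have hr0 : 0 < r := by linarith
  rw [eLpNorm_weighted hK hr0 hf, one_div, ENNReal.rpow_inv_le_iff hr0]

lemma memLp_of_lintegral_le (hK : AEMeasurable K) {u : PreMV n s p q V} {B : ℝ}
    (h : ∫⁻ x, ENNReal.ofReal (K x) * ‖u.toFun x‖ₑ ^ r ≤ ENNReal.ofReal B ^ r) :
    MemLp u.toFun (ENNReal.ofReal r) (weighted n K) :=
  ⟨u.continuous.aestronglyMeasurable, ((eLpNorm_weighted_le_iff hK u.continuous.measurable _).2
    h).trans_lt ENNReal.ofReal_lt_top⟩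

/-- The inclusion of the test functions into `L^r(K)`, given the weighted inequality. -/
noncomputable def inclusionOfBound (hK : AEMeasurable K) (C : ℝ)
    (h : ∀ u : PreMV n s p q V, ∫⁻ x, ENNReal.ofReal (K x) * ‖u.toFun x‖ₑ ^ r ≤
      ENNReal.ofReal (C * ‖u‖) ^ r) :
    PreMV n s p q V →L[ℝ] Lp ℝ (ENNReal.ofReal r) (weighted n K) :=
  have hmem (u : PreMV n s p q V) : MemLp u.toFun (ENNReal.ofReal r) (weighted n K) :=
    memLp_of_lintegral_le hK (h u)
  LinearMap.mkContinuous
    { toFun := fun u => (hmem u).toLp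
      map_add' := fun u v => MemLp.toLp_add (hmem u) (hmem v)
      map_smul' := fun c u => MemLp.toLp_const_smul c (hmem u) } (max C 0) fun u => by
    have h1 : ENNReal.ofReal (C * ‖u‖) ≤ ENNReal.ofReal (max C 0 * ‖u‖) := by
      gcongr; exact le_max_left _ _
    exact (Lp.norm_toLp _ (hmem u)).le.trans
      (ENNReal.toReal_le_of_le_ofReal (by positivity)
        (((eLpNorm_weighted_le_iff hK u.continuous.measurable _).2 (h u)).trans h1))

lemma inclusionOfBound_ae_eq (hK : AEMeasurable K) (C : ℝ)
    (h : ∀ u : PreMV n s p q V, ∫⁻ x, ENNReal.ofReal (K x) * ‖u.toFun x‖ₑ ^ r ≤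
      ENNReal.ofReal (C * ‖u‖) ^ r) (u : PreMV n s p q V) :
    inclusionOfBound hK C h u =ᵐ[weighted n K] u.toFun :=
  MemLp.coeFn_toLp (memLp_of_lintegral_le hK (h u))

lemma coeFn_finset_sum {α ι : Type*} [MeasurableSpace α] {μ : Measure α} {p : ℝ≥0∞}
    (S : Finset ι) (f : ι → Lp ℝ p μ) : ⇑(∑ k ∈ S, f k) =ᵐ[μ] fun x => ∑ k ∈ S, f k x := by
  classical
  induction S using Finset.induction_on with
  | empty =>
    simp only [Finset.sum_empty]
    exact Lp.coeFn_zero (E := ℝ) (p := p) (μ := μ)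
  | insert k S hk ih =>
    rw [Finset.sum_insert hk]
    filter_upwards [Lp.coeFn_add (f k) (∑ k ∈ S, f k), ih] with x h1 h2
    rw [h1, Pi.add_apply, h2, Finset.sum_insert hk]

/-- The step approximation as a linear map with values in `L^r(K)`. -/
noncomputable def stepMap {ι : Type*} [Fintype ι] {Q : ι → Set (EuclideanSpace ℝ (Fin n))}
    (hQm : ∀ k, MeasurableSet (Q k)) (hQt : ∀ k, weighted n K (Q k) ≠ ∞) :
    PreMV n s p q V →ₗ[ℝ] Lp ℝ (ENNReal.ofReal r) (weighted n K) where
  toFun u := ∑ k, (⨍ y in Q k, u.toFun y) • indicatorConstLp _ (hQm k) (hQt k) 1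
  map_add' u v := by
    rw [← Finset.sum_add_distrib]
    refine Finset.sum_congr rfl fun k _ => ?_
    rw [← add_smul]
    congr 1
    simp only [average_eq, PreMV.toFun_add, Pi.add_apply]
    rw [integral_add (u.continuous.integrable_of_hasCompactSupport u.mem.2.1).restrict
      (v.continuous.integrable_of_hasCompactSupport v.mem.2.1).restrict, smul_add]
  map_smul' c u := by
    rw [RingHom.id_apply, Finset.smul_sum]
    refine Finset.sum_congr rfl fun k _ => ?_
    rw [smul_smul]
    congr 1
    simp only [average_eq, PreMV.toFun_smul, Pi.smul_apply, smul_eq_mul, integral_const_mul]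
    ring

lemma stepMap_ae_eq {ι : Type*} [Fintype ι] {Q : ι → Set (EuclideanSpace ℝ (Fin n))}
    (hQm : ∀ k, MeasurableSet (Q k)) (hQt : ∀ k, weighted n K (Q k) ≠ ∞) (u : PreMV n s p q V) :
    stepMap (r := r) hQm hQt u =ᵐ[weighted n K] stepApprox Q u.toFun := by
  have h1 : (stepMap (r := r) hQm hQt u : Lp ℝ (ENNReal.ofReal r) (weighted n K)) =
      ∑ k, (⨍ y in Q k, u.toFun y) • indicatorConstLp _ (hQm k) (hQt k) 1 := rfl
  rw [h1]
  refine (coeFn_finset_sum _ _).trans ?_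
  have h2 : ∀ᵐ x ∂weighted n K, ∀ k, ((⨍ y in Q k, u.toFun y) •
      indicatorConstLp (ENNReal.ofReal r) (hQm k) (hQt k) (1 : ℝ) :
        Lp ℝ (ENNReal.ofReal r) (weighted n K)) x =
      (Q k).indicator (fun _ => ⨍ y in Q k, u.toFun y) x := by
    refine ae_all_iff.2 fun k => ?_
    filter_upwards [Lp.coeFn_smul (⨍ y in Q k, u.toFun y)
      (indicatorConstLp (ENNReal.ofReal r) (hQm k) (hQt k) (1 : ℝ)),
      indicatorConstLp_coeFn (p := ENNReal.ofReal r) (hs := hQm k) (hμs := hQt k) (c := (1 : ℝ))]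
      with x h1 h2
    rw [h1, Pi.smul_apply, h2]
    by_cases hx : x ∈ Q k <;> simp [hx]
  filter_upwards [h2] with x hx
  simp only [hx, stepApprox]

lemma norm_sub_stepMap_le (hK : AEMeasurable K) {f : Lp ℝ (ENNReal.ofReal r) (weighted n K)}
    {u : PreMV n s p q V} (hf : f =ᵐ[weighted n K] u.toFun) {ι : Type*} [Fintype ι]
    {Q : ι → Set (EuclideanSpace ℝ (Fin n))}
    (hQm : ∀ k, MeasurableSet (Q k)) (hQt : ∀ k, weighted n K (Q k) ≠ ∞) {B : ℝ} (hB : 0 ≤ B)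
    (h : ∫⁻ x, ENNReal.ofReal (K x) * ‖u.toFun x - stepApprox Q u.toFun x‖ₑ ^ r ≤
      ENNReal.ofReal B ^ r) :
    ‖f - stepMap (r := r) hQm hQt u‖ ≤ B := by
  rw [Lp.norm_def]
  refine ENNReal.toReal_le_of_le_ofReal hB ?_
  have hae : (f - stepMap (r := r) hQm hQt u : Lp ℝ (ENNReal.ofReal r) (weighted n K))
      =ᵐ[weighted n K] fun x => u.toFun x - stepApprox Q u.toFun x := by
    filter_upwards [Lp.coeFn_sub f (stepMap (r := r) hQm hQt u), hf,
      stepMap_ae_eq (r := r) hQm hQt u]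
      with x h1 h2 h3
    rw [h1, Pi.sub_apply, h2, h3]
  rw [eLpNorm_congr_ae hae]
  exact (eLpNorm_weighted_le_iff hK
    (u.continuous.measurable.sub (measurable_stepApprox hQm)) _).2 h

/-- Ensures that indicators of the cubes lie in L^r(K). -/
lemma weighted_ne_top_of_subset {t : ℝ≥0∞} (ht : 1 ≤ t) {D Q : Set (EuclideanSpace ℝ (Fin n))}
    (hD : IsCompact D) (hKD : MemLp K t (volume.restrict D)) (hQ : MeasurableSet Q)
    (hQD : Q ⊆ D) : weighted n K Q ≠ ∞ := by
  have : IsFiniteMeasure (volume.restrict D) := ⟨by simpa using hD.measure_lt_top⟩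
  have h := (hKD.integrable ht).lintegral_lt_top
  rw [weighted, withDensity_apply _ hQ]
  exact ((lintegral_mono_set hQD).trans_lt h).ne

/-- Test functions that are Cauchy and tend to zero in `L^r(K)` tend to zero. -/
lemma tendsto_norm_zero_of_tendsto (hK : AEMeasurable K) (hK0 : ∀ x, 0 < K x)
    {f : ℕ → Lp ℝ (ENNReal.ofReal r) (weighted n K)} {u : ℕ → PreMV n s p q V}
    (hfu : ∀ k, f k =ᵐ[weighted n K] (u k).toFun) (hu : CauchySeq u)
    (hf : Tendsto f atTop (𝓝 0)) : Tendsto (fun k => ‖u k‖) atTop (𝓝 0) := by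
  obtain ⟨φ, hφ, hlim⟩ := (tendstoInMeasure_of_tendsto_Lp hf).exists_seq_tendsto_ae
  have hlim' : ∀ᵐ x, Tendsto (fun j => (u (φ j)).toFun x) atTop (𝓝 0) := by
    refine (absolutelyContinuous_weighted hK hK0).ae_le ?_
    filter_upwards [hlim, ae_all_iff.2 hfu, Lp.coeFn_zero (E := ℝ) (p := ENNReal.ofReal r) (μ := weighted n K)]
      with x h1 h2 h3
    simpa only [h2, h3, Pi.zero_apply] using h1
  rw [Metric.tendsto_atTop]
  intro ε hε
  obtain ⟨M, hM⟩ := Metric.cauchySeq_iff.1 hu (ε / 3) (by positivity)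
  refine ⟨M, fun k hk => ?_⟩
  rw [Real.dist_0_eq_abs, abs_norm]
  -- Fix k and let j grow: the differences tend a.e. to `u k` and have norm at most `ε/3`. The shift
  -- by M keeps the index `φ (j + M)` at least M.
  have h1 : ‖u k‖ ≤ 2 * (ε / 3) := by
    refine PreMV.norm_le_of_tendsto (u := fun j => u k - u (φ (j + M))) (fun j => ?_) ?_
    · rw [← dist_eq_norm]
      exact (hM k hk _ (le_trans (by omega) hφ.le_apply)).le
    · filter_upwards [hlim'] with x hx
      have h2 := (hx.comp (tendsto_add_atTop_nat M)).const_sub ((u k).toFun x)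
      rw [sub_zero] at h2
      refine h2.congr fun j => ?_
      have h3 := congrFun (PreMV.toFun_add (u k - u (φ (j + M))) (u (φ (j + M)))) x
      rw [sub_add_cancel, Pi.add_apply] at h3
      simp only [Function.comp_apply]
      linarith
  linarith

end Embedding

end FracSobolev

/-! ### The embedding theorem. -/

theorem corollary8 (n : ℕ) (hn : 2 ≤ n) (s p q r : ℝ)
    [Fact (1 ≤ p)] [Fact (1 ≤ q)] [Fact (1 ≤ r)]
    (hs0 : 0 < s) (hs1 : s < 1) (hsp : s * p < n)
    (hr : FracSobolev.critExp n s p ≤ r) (hrq : r < q)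
    (K V : EuclideanSpace ℝ (Fin n) → ℝ)
    (hK : AEMeasurable K) (hV : AEMeasurable V)
    (hK0 : ∀ x, 0 < K x) (hV0 : ∀ x, 0 < V x)
    -- the infimum of `V` over each compact set is positive
    (hVloc : ∀ D : Set (EuclideanSpace ℝ (Fin n)), IsCompact D → ∃ c : ℝ, 0 < c ∧ ∀ x ∈ D, c ≤ V x)
    (t : ℝ≥0∞) (ht : ENNReal.ofReal (q / (q - r)) < t)
    (hKloc : ∀ D : Set (EuclideanSpace ℝ (Fin n)), IsCompact D → MemLp K t (volume.restrict D))
    (τ : ℝ) (hτ : r / (q - r) ≤ τ)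
    -- for `r = p*_s` the exponent `ψ(τ)` only makes sense at the endpoint
    (hτr : r = FracSobolev.critExp n s p → τ = r / (q - r))
    (hKV : Integrable fun x =>
      K x ^ FracSobolev.psi (FracSobolev.critExp n s p) q r τ * V x ^ (-τ)) :
    ∃ ι : FracSobolev.MV n s p q V →L[ℝ] Lp ℝ (ENNReal.ofReal r) (FracSobolev.weighted n K),
      (∀ u : FracSobolev.PreMV n s p q V,
        ι (u : FracSobolev.MV n s p q V) =ᵐ[FracSobolev.weighted n K] u.toFun) ∧
      Function.Injective ι ∧ IsCompactOperator ι := by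
  have hn0 : 0 < n := by omega
  have hr0 : 0 < r := by linarith [(Fact.out : 1 ≤ r)]
  have hK1 : 1 ≤ t := by
    refine le_trans ?_ ht.le
    rw [ENNReal.one_le_ofReal, le_div_iff₀ (by linarith)]
    linarith
  obtain ⟨C, w, hC, hw, hbound⟩ := FracSobolev.exists_setLIntegral_weight_le hn0 hs0 hsp hr hrq
    hK hV hK0 hV0 hτ hτr
  have hg : ∫⁻ x, ENNReal.ofReal
      (K x ^ FracSobolev.psi (FracSobolev.critExp n s p) q r τ * V x ^ (-τ)) ≠ ∞ :=
    hKV.lintegral_lt_top.ne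
  set I := ∫⁻ x, ENNReal.ofReal
    (K x ^ FracSobolev.psi (FracSobolev.critExp n s p) q r τ * V x ^ (-τ))
  have hB : (C * I ^ w) ^ (1 / r) ≠ ∞ := ENNReal.rpow_ne_top_of_nonneg (by positivity)
    (ENNReal.mul_ne_top hC (ENNReal.rpow_ne_top_of_nonneg hw.le hg))
  have hle (u : FracSobolev.PreMV n s p q V) :
      ∫⁻ x, ENNReal.ofReal (K x) * ‖u.toFun x‖ₑ ^ r ≤
        ENNReal.ofReal (((C * I ^ w) ^ (1 / r)).toReal * ‖u‖) ^ r := by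
    rw [ENNReal.ofReal_mul ENNReal.toReal_nonneg, ENNReal.ofReal_toReal hB,
      ENNReal.mul_rpow_of_nonneg _ _ hr0.le, ← ENNReal.rpow_mul, one_div_mul_cancel hr0.ne',
      ENNReal.rpow_one]
    -- Continuity is the localized inequality on the whole space.
    have h := hbound Set.univ u
    simp only [Measure.restrict_univ] at h
    exact h.trans (le_of_eq (by ring))
  let f := FracSobolev.inclusionOfBound hK _ hle
  have hf (u) : f u =ᵐ[FracSobolev.weighted n K] u.toFun :=
    FracSobolev.inclusionOfBound_ae_eq hK _ hle u
  refine ⟨f.fromCompletion, fun u => ?_, ?_, ?_⟩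
  · rw [ContinuousLinearMap.fromCompletion_apply_coe]
    exact hf u
  · exact FracSobolev.injective_fromCompletion f fun u hu hlim =>
      FracSobolev.tendsto_norm_zero_of_tendsto hK hK0 (fun k => hf (u k)) hu hlim
  · refine FracSobolev.isCompactOperator_fromCompletion f fun ε hε => ?_
    obtain ⟨ι, hι, Q, D, hD, hQD, hQm, hQ⟩ := FracSobolev.exists_stepApprox_weight_le hn0 hs0 hsp
      hr hrq hK hV hK0 hV0 hVloc ht hKloc hτ hτr hKV hε
    have hQt (k) := FracSobolev.weighted_ne_top_of_subset hK1 hD (hKloc D hD) (hQm k) (hQD k)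
    -- The range is spanned by the indicators of finitely many cubes, which do not depend on u.
    refine ⟨FracSobolev.stepMap hQm hQt, Submodule.span ℝ
      (Set.range fun k => indicatorConstLp _ (hQm k) (hQt k) 1), ?_, fun u => ?_, fun u => ?_⟩
    · exact FiniteDimensional.span_of_finite ℝ (Set.finite_range _)
    · exact Submodule.sum_mem _ fun k _ => Submodule.smul_mem _ _
        (Submodule.subset_span (Set.mem_range_self k))
    · exact FracSobolev.norm_sub_stepMap_le hK (hf u) hQm hQt (by positivity) (hQ u)
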